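/- An \emph{ACDL} is an algebraic (compactly generated) completely distributive complete lattice; $2$ is the two-element lattice. For ACDLs $C,D$ let $C\otimes D$ (resp. $C\boxtimes D$) be the complete tensor product of the underlying complete join-semilattices (resp. meet-semilattices), i.e. the complete semilattice representing $\bigvee$-bilinear (resp. $\bigwedge$-bilinear) maps, and let $\omega\colon C\otimes D\cong C\boxtimes D$ be the canonical lattice isomorphism with $\omega(c\otimes 1)=c\boxtimes 0$ and $\omega(1\otimes d)=0\boxtimes d$ (both represent the coproduct of $C$ and $D$). \textbf{Comonoids.} A comonoid is an ACDL $C$ with maps $\bar\gamma\colon C\to C\boxtimes C$ and $\epsilon\colon C\to 2$ preserving all joins and meets such that $(\bar\gamma\boxtimes \mathrm{id})\bar\gamma=(\mathrm{id}\boxtimes\bar\gamma)\bar\gamma$ and $(\epsilon\boxtimes\mathrm{id})\bar\gamma=\mathrm{id}=(\mathrm{id}\boxtimes\epsilon)\bar\gamma$ up to the canonical isomorphisms. Put $\gamma=\omega^{-1}\bar\gamma$. A pure morphism $f\colon C\to C'$ preserves all joins and meets and satisfies $(f\boxtimes f)\bar\gamma=\bar\gamma' f$, $\epsilon=\epsilon'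 f$. A corelational morphism $\rho\colon C\to C'$ preserves all joins and satisfies $\rho(1)=1$, $(\rho\otimes\rho)\gamma\le\gamma'\rho$, $\epsilon\le\epsilon'\rho$. The categories are $\mathbf{Comon}$ and $\mathbf{RelComon}$. \textbf{Derivation ACDLs.} A derivation ACDL is an ACDL $R$ with residuals $\backslash\colon R^{\partial}\times R\to R$ and $/\colon R\times R^{\partial}\to R$ preserving all meets in each variable such that $b\le a\backslash c\iff a\le c/b$; $x\backslash(z/y)=(x\backslash z)/y$; there is a completely join-prime $e\in R$ with $e\backslash z=z=z/e$ for all $z$; and for every completely join-prime $p$ the maps $p\backslash(-)$ and $(-)/p$ preserve all joins. A residuation morphism $f\colon R\to S$ preserves all joins and meets and satisfies $f(x\backslash z)\le f(x)\backslash f(z)$ and $f(z/x)\le f(z)/f(x)$; for all $y\in S$, $z\in R$ there is $x\in R$ with $y\le f(x)$ and $y\backslash f(z)=f(x\backslash z)$, and there is $x\in R$ with $y\le f(x)$ and $f(z)/y=f(z/x)$; and $e\le x\iff e'\le f(x)$. A corelational morphism $\rho\colon R\to S$ preserves all joins and satisfies $\rho(1)=1$, $\rho(x\backslash z)\le\rho(x)\backslash\rho(z)$,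 $e'\le\rho(e)$. The categories are $\mathbf{DerACDL}$ and $\mathbf{RelDerACDL}$. \textbf{Ordered monoids.} An ordered monoid is a (not necessarily commutative) monoid with a partial order for which multiplication is monotone in each argument; $\mathbf{OrdMon}$ has the monotone monoid homomorphisms as morphisms. A relational morphism from $M$ to $N$ is a monotone map $\rho$ from $M$ to the nonempty downsets of $N$, ordered by inclusion, with $\rho(x)\rho(y)\subseteq\rho(xy)$ and $1_N\in\rho(1_M)$; these are composed as relations, the identity being $x\mapsto{\downarrow}x$, and form $\mathbf{RelOrdMon}$. \textbf{Theorem.} (1) The category $\mathbf{OrdMon}$ is dually equivalent to $\mathbf{Comon}$, which is isomorphic to $\mathbf{DerACDL}$: $$\mathbf{OrdMon}\simeq^{\mathrm{op}}\mathbf{Comon}\cong\mathbf{DerACDL}.$$ (2) The category $\mathbf{RelOrdMon}$ is dually equivalent to $\mathbf{RelComon}$, which is isomorphic to $\mathbf{RelDerACDL}$: $$\mathbf{RelOrdMon}\simeq^{\mathrm{op}}\mathbf{RelComon}\cong\mathbf{RelDerACDL}.$$ In (1) and (2) the dual equivalence and the isomorphism can be chosen so that they restrict to a dual equivalence and an isomorphism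 of the respective full subcategories of objects with finite carrier. -/

import Mathlib

open CategoryTheory

universe u v w

namespace OrdDual

section Tensor

variable {J J' J'' K K' K'' L : Type*} [CompleteLattice J] [CompleteLattice J']
  [CompleteLattice J''] [CompleteLattice K] [CompleteLattice K'] [CompleteLattice K'']
  [CompleteLattice L]

/-- The complete tensor product of two complete join-semilattices `J` and `K`, presented by
generators `j ⊗ k` subject to `(⋁ A) ⊗ (⋁ B) = ⋁ {a ⊗ b | a ∈ A, b ∈ B}` for all `A ⊆ J`, `B ⊆ K`.
An element is represented by the set of all pairs `(j, k)` such that `j ⊗ k` lies below it; these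
are the downsets of `J × K` that are closed under the defining relations. -/
structure JTensor (J K : Type*) [CompleteLattice J] [CompleteLattice K] where
  carrier : Set (J × K)
  lower : IsLowerSet carrier
  sSup_mem : ∀ (A : Set J) (B : Set K), (∀ a ∈ A, ∀ b ∈ B, (a, b) ∈ carrier) →
    (sSup A, sSup B) ∈ carrier

namespace JTensor

theorem ext {S T : JTensor J K} (h : S.carrier = T.carrier) : S = T := by
  cases S; cases T; cases h; rfl

instance : PartialOrder (JTensor J K) where
  le S T := S.carrier ⊆ T.carrier
  le_refl _ := subset_rfl
  le_trans _ _ _ h h' := h.trans h'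
  le_antisymm _ _ h h' := ext (h.antisymm h')

instance : InfSet (JTensor J K) where
  sInf F :=
    { carrier := {p | ∀ T ∈ F, p ∈ T.carrier}
      lower := fun _ _ h hp T hT => T.lower h (hp T hT)
      sSup_mem := fun A B h T hT => T.sSup_mem A B fun a ha b hb => h a ha b hb T hT }

instance : CompleteLattice (JTensor J K) :=
  completeLatticeOfInf _ fun _ =>
    ⟨fun _ hT _ hp => hp _ hT, fun _ hS _ hp _ hT => hS hT hp⟩

/-- The pure tensor `j ⊗ k`. -/
def tmul (j : J) (k : K) : JTensor J K := sInf {T | (j, k) ∈ T.carrier}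

theorem tmul_le_iff {j : J} {k : K} {T : JTensor J K} : tmul j k ≤ T ↔ (j, k) ∈ T.carrier :=
  ⟨fun h => h fun _ hS => hS, fun h => sInf_le h⟩

theorem le_iff {S T : JTensor J K} : S ≤ T ↔ ∀ j k, tmul j k ≤ S → tmul j k ≤ T :=
  ⟨fun h _ _ h' => h'.trans h, fun h p hp => tmul_le_iff.1 (h p.1 p.2 (tmul_le_iff.2 hp))⟩

theorem tmul_mono {j j' : J} {k k' : K} (h : j ≤ j') (h' : k ≤ k') : tmul j k ≤ tmul j' k' :=
  tmul_le_iff.2 ((tmul j' k').lower (show (j, k) ≤ (j', k') from ⟨h, h'⟩)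
    (tmul_le_iff.1 le_rfl))

end JTensor

/-- `⋁`-bilinear maps. -/
def IsBiSup (b : J → K → L) : Prop :=
  (∀ A k, b (sSup A) k = ⨆ a ∈ A, b a k) ∧ (∀ j B, b j (sSup B) = ⨆ k ∈ B, b j k)

/-- `⋀`-bilinear maps. -/
def IsBiInf (b : J → K → L) : Prop :=
  (∀ A k, b (sInf A) k = ⨅ a ∈ A, b a k) ∧ (∀ j B, b j (sInf B) = ⨅ k ∈ B, b j k)

theorem IsBiSup.mono {b : J → K → L} (hb : IsBiSup b) {j j' : J} {k k' : K} (h : j ≤ j')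
    (h' : k ≤ k') : b j k ≤ b j' k' := by
  have h1 := hb.1 {j, j'} k
  have h2 := hb.2 j' {k, k'}
  rw [sSup_pair, sup_eq_right.2 h] at h1
  rw [sSup_pair, sup_eq_right.2 h'] at h2
  calc b j k ≤ b j' k := by rw [h1]; exact le_iSup₂_of_le j (by simp) le_rfl
    _ ≤ b j' k' := by rw [h2]; exact le_iSup₂_of_le k (by simp) le_rfl

theorem IsBiSup.map_biSup_right {b : J → K → L} (hb : IsBiSup b) {ι : Type*} (j : J) (s : Set ι)
    (f : ι → K) : b j (⨆ i ∈ s, f i) = ⨆ i ∈ s, b j (f i) := by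
  rw [← sSup_image, hb.2, iSup_image]

namespace JTensor

theorem isBiSup_tmul : IsBiSup (tmul : J → K → JTensor J K) := by
  constructor
  · intro A k
    apply le_antisymm
    · rw [tmul_le_iff]
      have := (⨆ a ∈ A, tmul a k).sSup_mem A {k} (by
        rintro a ha _ rfl
        exact tmul_le_iff.1 (le_iSup₂_of_le a ha le_rfl))
      simpa using this
    · exact iSup₂_le fun a ha => tmul_mono (le_sSup ha) le_rfl
  · intro j B
    apply le_antisymm
    · rw [tmul_le_iff]
      have := (⨆ k ∈ B, tmul j k).sSup_mem {j} B (by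
        rintro _ rfl k hk
        exact tmul_le_iff.1 (le_iSup₂_of_le k hk le_rfl))
      simpa using this
    · exact iSup₂_le fun k hk => tmul_mono le_rfl (le_sSup hk)

/-- The largest element of the tensor product whose pure tensors are sent below `l`. -/
def liftAdj (b : J → K → L) (hb : IsBiSup b) (l : L) : JTensor J K where
  carrier := {p | b p.1 p.2 ≤ l}
  lower := fun _ _ h hp => (hb.mono h.1 h.2).trans hp
  sSup_mem := fun A B h => by
    change b (sSup A) (sSup B) ≤ l
    rw [hb.1]
    refine iSup₂_le fun a ha => ?_
    rw [hb.2]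
    exact iSup₂_le fun k hk => h a ha k hk

theorem gc_lift (b : J → K → L) (hb : IsBiSup b) :
    GaloisConnection (fun T : JTensor J K => ⨆ p ∈ T.carrier, b p.1 p.2) (liftAdj b hb) :=
  fun _ _ => iSup₂_le_iff

/-- The morphism of complete join-semilattices with `j ⊗ k ↦ b j k`, for `⋁`-bilinear `b`. -/
def lift (b : J → K → L) (hb : IsBiSup b) : sSupHom (JTensor J K) L where
  toFun T := ⨆ p ∈ T.carrier, b p.1 p.2
  map_sSup' F := by
    rw [(gc_lift b hb).l_sSup, sSup_image]

theorem lift_apply (b : J → K → L) (hb : IsBiSup b) (T : JTensor J K) :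
    lift b hb T = ⨆ p ∈ T.carrier, b p.1 p.2 := rfl

theorem lift_tmul (b : J → K → L) (hb : IsBiSup b) (j : J) (k : K) :
    lift b hb (tmul j k) = b j k :=
  eq_of_forall_ge_iff fun l => ((gc_lift b hb) (tmul j k) l).trans tmul_le_iff

theorem eq_iSup_tmul (T : JTensor J K) : T = ⨆ p ∈ T.carrier, tmul p.1 p.2 := by
  apply le_antisymm
  · rw [le_iff]
    intro j k h
    exact le_iSup₂_of_le (j, k) (tmul_le_iff.1 h) le_rfl
  · exact iSup₂_le fun p hp => tmul_le_iff.2 hp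

theorem hom_ext {f g : sSupHom (JTensor J K) L} (h : ∀ j k, f (tmul j k) = g (tmul j k)) :
    f = g := by
  ext T
  rw [eq_iSup_tmul T]
  simp only [map_iSup, h]

theorem isBiSup_map (f : sSupHom J J') (g : sSupHom K K') :
    IsBiSup fun j k => tmul (f j) (g k) := by
  constructor
  · intro A k
    simp only [map_sSup, isBiSup_tmul.1, iSup_image]
  · intro A k
    simp only [map_sSup, isBiSup_tmul.2, iSup_image]

/-- The tensor product `f ⊗ g` of morphisms of complete join-semilattices. -/
def map (f : sSupHom J J') (g : sSupHom K K') : sSupHom (JTensor J K) (JTensor J' K') :=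
  lift (fun j k => tmul (f j) (g k)) (isBiSup_map f g)

theorem map_tmul (f : sSupHom J J') (g : sSupHom K K') (j : J) (k : K) :
    map f g (tmul j k) = tmul (f j) (g k) := lift_tmul _ _ _ _

theorem map_id : map (sSupHom.id J) (sSupHom.id K) = sSupHom.id (JTensor J K) :=
  hom_ext fun j k => map_tmul _ _ j k

theorem map_comp (f' : sSupHom J' J'') (f : sSupHom J J') (g' : sSupHom K' K'')
    (g : sSupHom K K') : map (f'.comp f) (g'.comp g) = (map f' g').comp (map f g) :=
  hom_ext fun j k => by simp [map_tmul]

theorem isBiSup_assocAux (z : L) : IsBiSup fun (x : J) (y : K) => tmul x (tmul y z) := by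
  constructor
  · intro A y
    exact isBiSup_tmul.1 A _
  · intro x B
    simp only [isBiSup_tmul.1, isBiSup_tmul.map_biSup_right]

theorem isBiSup_assoc : IsBiSup fun (T : JTensor J K) (z : L) =>
    lift (fun x y => tmul x (tmul y z)) (isBiSup_assocAux z) T := by
  constructor
  · intro A z
    simp only [map_sSup, sSup_image]
  · intro T B
    simp only [lift_apply, isBiSup_tmul.2, isBiSup_tmul.map_biSup_right]
    apply le_antisymm
    · refine iSup₂_le fun p hp => iSup₂_le fun z hz => ?_
      exact le_iSup₂_of_le z hz (le_iSup₂_of_le p hp le_rfl)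
    · refine iSup₂_le fun z hz => iSup₂_le fun p hp => ?_
      exact le_iSup₂_of_le p hp (le_iSup₂_of_le z hz le_rfl)

/-- The associator `(J ⊗ K) ⊗ L → J ⊗ (K ⊗ L)`, `(x ⊗ y) ⊗ z ↦ x ⊗ (y ⊗ z)`. -/
def assoc (J K L : Type*) [CompleteLattice J] [CompleteLattice K] [CompleteLattice L] :
    sSupHom (JTensor (JTensor J K) L) (JTensor J (JTensor K L)) :=
  lift (fun T z => lift (fun x y => tmul x (tmul y z)) (isBiSup_assocAux z) T) isBiSup_assoc

theorem assoc_tmul (x : J) (y : K) (z : L) :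
    assoc J K L (tmul (tmul x y) z) = tmul x (tmul y z) := by
  rw [assoc, lift_tmul, lift_tmul]

end JTensor
open OrderDual

/-- The complete tensor product of two complete meet-semilattices, the order-dual of `JTensor`. -/
def MTensor (J K : Type*) [CompleteLattice J] [CompleteLattice K] : Type _ :=
  (JTensor Jᵒᵈ Kᵒᵈ)ᵒᵈ

instance : CompleteLattice (MTensor J K) :=
  inferInstanceAs (CompleteLattice (JTensor Jᵒᵈ Kᵒᵈ)ᵒᵈ)

theorem IsBiInf.dual {b : J → K → L} (hb : IsBiInf b) :
    IsBiSup fun (x : Jᵒᵈ) (y : Kᵒᵈ) => toDual (b (ofDual x) (ofDual y)) :=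
  ⟨fun A k => hb.1 A k, fun j B => hb.2 j B⟩

theorem IsBiInf.map_biInf_right {b : J → K → L} (hb : IsBiInf b) {ι : Type*} (j : J) (s : Set ι)
    (f : ι → K) : b j (⨅ i ∈ s, f i) = ⨅ i ∈ s, b j (f i) := by
  rw [← sInf_image, hb.2, iInf_image]

theorem IsBiInf.flip {b : J → K → L} (hb : IsBiInf b) : IsBiInf fun k j => b j k :=
  ⟨fun A k => hb.2 k A, fun j B => hb.1 B j⟩

namespace MTensor

/-- The pure tensor `j ⊠ k`. -/
def tmul (j : J) (k : K) : MTensor J K := toDual (JTensor.tmul (toDual j) (toDual k))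

/-- The pairs `(j, k)` such that `j ⊠ k` lies above the given element. -/
def pairs (S : MTensor J K) : Set (J × K) := {p | S ≤ tmul p.1 p.2}

theorem mem_pairs {S : MTensor J K} {p : J × K} : p ∈ S.pairs ↔ S ≤ tmul p.1 p.2 := Iff.rfl

theorem mem_pairs_iff {S : MTensor J K} {p : J × K} :
    p ∈ S.pairs ↔ (toDual p.1, toDual p.2) ∈ JTensor.carrier (ofDual S) :=
  JTensor.tmul_le_iff

theorem isBiInf_tmul : IsBiInf (tmul : J → K → MTensor J K) :=
  ⟨fun A k => (JTensor.isBiSup_tmul (J := Jᵒᵈ) (K := Kᵒᵈ)).1 A k,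
    fun j B => (JTensor.isBiSup_tmul (J := Jᵒᵈ) (K := Kᵒᵈ)).2 j B⟩

/-- The morphism of complete meet-semilattices with `j ⊠ k ↦ b j k`, for `⋀`-bilinear `b`. -/
def lift (b : J → K → L) (hb : IsBiInf b) : sInfHom (MTensor J K) L where
  toFun S := ofDual (JTensor.lift _ hb.dual (ofDual S))
  map_sInf' F := (JTensor.lift _ hb.dual).map_sSup' F

theorem lift_tmul (b : J → K → L) (hb : IsBiInf b) (j : J) (k : K) :
    lift b hb (tmul j k) = b j k :=
  JTensor.lift_tmul _ hb.dual (toDual j) (toDual k)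

theorem lift_apply (b : J → K → L) (hb : IsBiInf b) (S : MTensor J K) :
    lift b hb S = ⨅ p ∈ S.pairs, b p.1 p.2 := by
  simp only [mem_pairs_iff]
  rfl

theorem eq_iInf_tmul (S : MTensor J K) : S = ⨅ p ∈ S.pairs, tmul p.1 p.2 := by
  simp only [mem_pairs_iff]
  exact JTensor.eq_iSup_tmul (J := Jᵒᵈ) (K := Kᵒᵈ) S

theorem hom_ext {f g : sInfHom (MTensor J K) L} (h : ∀ j k, f (tmul j k) = g (tmul j k)) :
    f = g := by
  ext S
  rw [eq_iInf_tmul S]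
  simp only [map_iInf, h]

theorem isBiInf_map (f : sInfHom J J') (g : sInfHom K K') :
    IsBiInf fun j k => tmul (f j) (g k) := by
  constructor
  · intro A k
    simp only [map_sInf, isBiInf_tmul.1, iInf_image]
  · intro A k
    simp only [map_sInf, isBiInf_tmul.2, iInf_image]

/-- The tensor product `f ⊠ g` of morphisms of complete meet-semilattices. -/
def map (f : sInfHom J J') (g : sInfHom K K') : sInfHom (MTensor J K) (MTensor J' K') :=
  lift (fun j k => tmul (f j) (g k)) (isBiInf_map f g)

theorem map_tmul (f : sInfHom J J') (g : sInfHom K K') (j : J) (k : K) :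
    map f g (tmul j k) = tmul (f j) (g k) := lift_tmul _ _ _ _

theorem map_id : map (sInfHom.id J) (sInfHom.id K) = sInfHom.id (MTensor J K) :=
  hom_ext fun j k => map_tmul _ _ j k

theorem map_comp (f' : sInfHom J' J'') (f : sInfHom J J') (g' : sInfHom K' K'')
    (g : sInfHom K K') : map (f'.comp f) (g'.comp g) = (map f' g').comp (map f g) :=
  hom_ext fun j k => by simp [map_tmul]

theorem isBiInf_assocAux (z : L) : IsBiInf fun (x : J) (y : K) => tmul x (tmul y z) := by
  constructor
  · intro A y
    exact isBiInf_tmul.1 A _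
  · intro x B
    simp only [isBiInf_tmul.1, isBiInf_tmul.map_biInf_right]

theorem isBiInf_assoc : IsBiInf fun (S : MTensor J K) (z : L) =>
    lift (fun x y => tmul x (tmul y z)) (isBiInf_assocAux z) S := by
  constructor
  · intro A z
    simp only [map_sInf, sInf_image]
  · intro S B
    simp only [lift_apply, isBiInf_tmul.2, isBiInf_tmul.map_biInf_right]
    apply le_antisymm
    · refine le_iInf₂ fun z hz => le_iInf₂ fun p hp => ?_
      exact iInf₂_le_of_le p hp (iInf₂_le_of_le z hz le_rfl)
    · refine le_iInf₂ fun p hp => le_iInf₂ fun z hz => ?_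
      exact iInf₂_le_of_le z hz (iInf₂_le_of_le p hp le_rfl)

/-- The associator `(J ⊠ K) ⊠ L → J ⊠ (K ⊠ L)`, `(x ⊠ y) ⊠ z ↦ x ⊠ (y ⊠ z)`. -/
def assoc (J K L : Type*) [CompleteLattice J] [CompleteLattice K] [CompleteLattice L] :
    sInfHom (MTensor (MTensor J K) L) (MTensor J (MTensor K L)) :=
  lift (fun S z => lift (fun x y => tmul x (tmul y z)) (isBiInf_assocAux z) S) isBiInf_assoc

theorem assoc_tmul (x : J) (y : K) (z : L) :
    assoc J K L (tmul (tmul x y) z) = tmul x (tmul y z) := by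
  rw [assoc, lift_tmul, lift_tmul]

theorem isBiInf_leftUnitor : IsBiInf fun (b : Prop) (k : K) => (⨆ _ : b, (⊤ : K)) ⊔ k := by
  constructor
  · intro A k
    by_cases h : sInf A
    · have h' : ∀ b ∈ A, b := by simpa using h
      simp only [h, iSup_pos, top_sup_eq]
      symm
      simp only [iInf_eq_top]
      intro b hb
      simp [h' b hb]
    · have : ∃ b ∈ A, ¬ b := by simpa using h
      obtain ⟨b, hb, hb'⟩ := this
      apply le_antisymm
      · simp [h]
      · exact iInf₂_le_of_le b hb (by simp [hb'])
  · intro b B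
    by_cases h : b <;> simp [h, sInf_eq_iInf]

/-- The left unitor `2 ⊠ K → K`, where `2` is the lattice `Prop`: `⊥ ⊠ k ↦ k`, `⊤ ⊠ k ↦ ⊤`. -/
def leftUnitor (K : Type*) [CompleteLattice K] : sInfHom (MTensor Prop K) K :=
  lift (fun (b : Prop) (k : K) => (⨆ _ : b, (⊤ : K)) ⊔ k) isBiInf_leftUnitor

/-- The right unitor `K ⊠ 2 → K`: `k ⊠ ⊥ ↦ k`, `k ⊠ ⊤ ↦ ⊤`. -/
def rightUnitor (K : Type*) [CompleteLattice K] : sInfHom (MTensor K Prop) K :=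
  lift (fun (k : K) (b : Prop) => (⨆ _ : b, (⊤ : K)) ⊔ k) isBiInf_leftUnitor.flip

end MTensor

/-- `p` is completely join-prime. -/
def IsCompletelyJoinPrime {α : Type*} [CompleteLattice α] (p : α) : Prop :=
  ∀ A : Set α, p ≤ sSup A → ∃ a ∈ A, p ≤ a

/-- `p` is completely join-prime and `m` is the largest element not above `p`. -/
def IsPrimePair {α : Type*} [CompleteLattice α] (p m : α) : Prop := ∀ z, p ≤ z ↔ ¬ z ≤ m

/-- The order is determined by the completely join-prime elements. -/
def PrimeSeparated (α : Type*) [CompleteLattice α] : Prop :=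
  ∀ x y : α, ¬ x ≤ y → ∃ p m : α, IsPrimePair p m ∧ p ≤ x ∧ y ≤ m

theorem IsPrimePair.dual {α : Type*} [CompleteLattice α] {p m : α} (h : IsPrimePair p m) :
    IsPrimePair (toDual m) (toDual p) :=
  fun z => (not_iff_comm.1 (h (ofDual z)).symm).symm

theorem PrimeSeparated.dual {α : Type*} [CompleteLattice α] (h : PrimeSeparated α) :
    PrimeSeparated αᵒᵈ := fun x y hxy => by
  obtain ⟨p, m, hpm, h1, h2⟩ := h (ofDual y) (ofDual x) hxy
  exact ⟨toDual m, toDual p, hpm.dual, h2, h1⟩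

theorem primeSeparated (α : Type*) [CompletelyDistribLattice α] [IsCompactlyGenerated α] :
    PrimeSeparated α := fun x y h => by
  have : ∃ k : α, IsCompactElement k ∧ k ≤ x ∧ ¬ k ≤ y := by
    by_contra! h'
    exact h (le_iff_compact_le_imp.2 h')
  obtain ⟨k, hk, hkx, hky⟩ := this
  rw [CompleteLattice.isCompactElement_iff_le_of_directed_sSup_le] at hk
  obtain ⟨m, hym, hm⟩ := zorn_le_nonempty₀ {z | ¬ k ≤ z} (by
    intro c hc hchain z hz
    refine ⟨sSup c, fun hle => ?_, fun z hz => le_sSup hz⟩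
    obtain ⟨w, hw, hkw⟩ := hk c ⟨z, hz⟩ hchain.directedOn hle
    exact hc hw hkw) y hky
  have hmk : ∀ z, ¬ z ≤ m → k ≤ m ⊔ z := by
    intro z hz
    by_contra hkz
    exact hz (le_sup_right.trans (hm.2 hkz le_sup_left))
  refine ⟨sInf {z | ¬ z ≤ m}, m, fun z => ⟨fun hz hzm => ?_, fun hz => sInf_le hz⟩,
    sInf_le fun hxm => hm.1 (hkx.trans hxm), hym⟩
  apply hm.1
  have h1 : m ⊔ sInf {z | ¬ z ≤ m} = m := sup_eq_left.2 (hz.trans hzm)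
  rw [← h1, sup_sInf_eq]
  exact le_iInf₂ hmk

namespace JTensor

theorem isPrimePair {p m : J} {q n : K} (hp : IsPrimePair p m) (hq : IsPrimePair q n) :
    IsPrimePair (tmul p q) (tmul m ⊤ ⊔ tmul ⊤ n) := by
  intro T
  let E : JTensor J K :=
    { carrier := {x | x.1 ≤ m ∨ x.2 ≤ n}
      lower := fun _ _ h hx => hx.imp h.1.trans h.2.trans
      sSup_mem := fun A B h => by
        by_contra hc
        simp only [Set.mem_ofPred_eq, sSup_le_iff, not_or, not_forall] at hc
        obtain ⟨⟨a, ha, ha'⟩, b, hb, hb'⟩ := hc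
        exact (h a ha b hb).elim ha' hb' }
  have hE : tmul m ⊤ ⊔ tmul ⊤ n = E := by
    apply le_antisymm
    · exact sup_le (tmul_le_iff.2 (Or.inl le_rfl)) (tmul_le_iff.2 (Or.inr le_rfl))
    · rw [le_iff]
      intro x y hxy
      rcases tmul_le_iff.1 hxy with h | h
      · exact le_sup_of_le_left (tmul_mono h le_top)
      · exact le_sup_of_le_right (tmul_mono le_top h)
  rw [hE, tmul_le_iff]
  constructor
  · intro h hT
    rcases hT h with h' | h'
    · exact (hp p).1 le_rfl h'
    · exact (hq q).1 le_rfl h'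
  · intro h
    by_contra hpq
    apply h
    rintro ⟨x, y⟩ hxy
    by_contra hc
    rcases not_or.1 hc with ⟨h1, h2⟩
    exact hpq (T.lower (show (p, q) ≤ (x, y) from ⟨(hp x).2 h1, (hq y).2 h2⟩) hxy)

theorem exists_primePair (hJ : PrimeSeparated J) (hK : PrimeSeparated K) {S T : JTensor J K}
    (h : ¬ S ≤ T) : ∃ (p m : J) (q n : K), IsPrimePair p m ∧ IsPrimePair q n ∧
      tmul p q ≤ S ∧ ¬ tmul p q ≤ T := by
  by_contra! hc
  apply h
  rw [le_iff]
  intro x y hxy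
  have hx : x ≤ sSup {p | (∃ m, IsPrimePair p m) ∧ p ≤ x} := by
    by_contra hn
    obtain ⟨p, m, hpm, h1, h2⟩ := hJ _ _ hn
    have hmem : p ∈ {p | (∃ m, IsPrimePair p m) ∧ p ≤ x} := ⟨⟨m, hpm⟩, h1⟩
    exact (hpm p).1 le_rfl ((le_sSup hmem).trans h2)
  have hy : y ≤ sSup {q | (∃ n, IsPrimePair q n) ∧ q ≤ y} := by
    by_contra hn
    obtain ⟨p, m, hpm, h1, h2⟩ := hK _ _ hn
    have hmem : p ∈ {q | (∃ n, IsPrimePair q n) ∧ q ≤ y} := ⟨⟨m, hpm⟩, h1⟩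
    exact (hpm p).1 le_rfl ((le_sSup hmem).trans h2)
  refine (tmul_mono hx hy).trans (tmul_le_iff.2 (T.sSup_mem _ _ ?_))
  rintro p ⟨⟨m, hpm⟩, hpx⟩ q ⟨⟨n, hqn⟩, hqy⟩
  exact tmul_le_iff.1 (hc p m q n hpm hqn ((tmul_mono hpx hqy).trans hxy))

end JTensor

namespace MTensor

theorem tmul_mono {j j' : J} {k k' : K} (h : j ≤ j') (h' : k ≤ k') : tmul j k ≤ tmul j' k' :=
  JTensor.tmul_mono (J := Jᵒᵈ) (K := Kᵒᵈ) h h'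

theorem isPrimePair {p m : J} {q n : K} (hp : IsPrimePair p m) (hq : IsPrimePair q n) :
    IsPrimePair (tmul p ⊥ ⊓ tmul ⊥ q) (tmul m n) :=
  (JTensor.isPrimePair hp.dual hq.dual).dual

theorem exists_primePair (hJ : PrimeSeparated J) (hK : PrimeSeparated K) {S T : MTensor J K}
    (h : ¬ S ≤ T) : ∃ (p m : J) (q n : K), IsPrimePair p m ∧ IsPrimePair q n ∧
      ¬ S ≤ tmul m n ∧ T ≤ tmul m n := by
  obtain ⟨m, p, n, q, hm, hn, h1, h2⟩ := JTensor.exists_primePair hJ.dual hK.dual h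
  exact ⟨ofDual p, ofDual m, ofDual q, ofDual n, hm.dual, hn.dual, h2, h1⟩

end MTensor

section Omega

variable {C D : Type*} [CompleteLattice C] [CompleteLattice D]

/-- The underlying function of the isomorphism `C ⊗ D ≅ C ⊠ D` for algebraic completely
distributive lattices, `⋁ᵢ cᵢ ⊗ dᵢ ↦ ⋁ᵢ (cᵢ ⊠ 0) ∧ (0 ⊠ dᵢ)`. -/
def omegaFun (T : JTensor C D) : MTensor C D :=
  ⨆ x ∈ T.carrier, MTensor.tmul x.1 ⊥ ⊓ MTensor.tmul ⊥ x.2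

/-- The underlying function of the inverse isomorphism,
`⋀ᵢ cᵢ ⊠ dᵢ ↦ ⋀ᵢ (cᵢ ⊗ 1) ∨ (1 ⊗ dᵢ)`. -/
def omegaInvFun (S : MTensor C D) : JTensor C D :=
  ⨅ x ∈ S.pairs, JTensor.tmul x.1 ⊤ ⊔ JTensor.tmul ⊤ x.2

theorem omegaFun_le {p m : C} {q n : D} (hp : IsPrimePair p m) (hq : IsPrimePair q n)
    (T : JTensor C D) : omegaFun T ≤ MTensor.tmul m n ↔ ¬ JTensor.tmul p q ≤ T := by
  rw [JTensor.isPrimePair hp hq T, not_not, omegaFun, iSup₂_le_iff]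
  constructor
  · intro h
    by_contra hT
    rw [← JTensor.isPrimePair hp hq T, JTensor.tmul_le_iff] at hT
    exact (MTensor.isPrimePair hp hq _).1 le_rfl (h (p, q) hT)
  · intro hT x hx
    by_contra hc
    rw [← MTensor.isPrimePair hp hq] at hc
    have h1 : ¬ x.1 ≤ m := fun h => (MTensor.isPrimePair hp hq _).1 le_rfl
      (hc.trans (inf_le_left.trans (MTensor.tmul_mono h bot_le)))
    have h2 : ¬ x.2 ≤ n := fun h => (MTensor.isPrimePair hp hq _).1 le_rfl
      (hc.trans (inf_le_right.trans (MTensor.tmul_mono bot_le h)))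
    refine (JTensor.isPrimePair hp hq T).1 ?_ hT
    exact JTensor.tmul_le_iff.2
      (T.lower (show (p, q) ≤ x from ⟨(hp _).2 h1, (hq _).2 h2⟩) hx)

theorem le_omegaInvFun {p m : C} {q n : D} (hp : IsPrimePair p m) (hq : IsPrimePair q n)
    (S : MTensor C D) : JTensor.tmul p q ≤ omegaInvFun S ↔ ¬ S ≤ MTensor.tmul m n := by
  rw [omegaInvFun, le_iInf₂_iff]
  constructor
  · intro h hS
    exact (JTensor.isPrimePair hp hq _).1 (h (m, n) hS) le_rfl
  · intro hS x hx
    by_contra hc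
    apply hS
    rw [JTensor.isPrimePair hp hq, not_not] at hc
    have h1 : x.1 ≤ m := by
      by_contra h
      refine (JTensor.isPrimePair hp hq _).1 ?_ ((le_sup_left).trans hc)
      exact JTensor.tmul_mono ((hp _).2 h) le_top
    have h2 : x.2 ≤ n := by
      by_contra h
      refine (JTensor.isPrimePair hp hq _).1 ?_ ((le_sup_right).trans hc)
      exact JTensor.tmul_mono le_top ((hq _).2 h)
    exact le_trans hx (MTensor.tmul_mono h1 h2)

/-- The isomorphism `C ⊗ D ≅ C ⊠ D` of algebraic completely distributive lattices. -/
def omega (C D : Type*) [CompletelyDistribLattice C] [IsCompactlyGenerated C]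
    [CompletelyDistribLattice D] [IsCompactlyGenerated D] : JTensor C D ≃o MTensor C D where
  toFun := omegaFun
  invFun := omegaInvFun
  left_inv T := by
    apply le_antisymm
    all_goals
      by_contra h
      obtain ⟨p, m, q, n, hp, hq, h1, h2⟩ :=
        JTensor.exists_primePair (primeSeparated C) (primeSeparated D) h
      simp only [le_omegaInvFun hp hq, omegaFun_le hp hq, not_not] at h1 h2
      exact h2 h1
  right_inv S := by
    apply le_antisymm
    all_goals
      by_contra h
      obtain ⟨p, m, q, n, hp, hq, h1, h2⟩ :=
        MTensor.exists_primePair (primeSeparated C) (primeSeparated D) h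
      simp only [le_omegaInvFun hp hq, omegaFun_le hp hq, not_not] at h1 h2
      exact h1 h2
  map_rel_iff' := by
    intro S T
    change omegaFun S ≤ omegaFun T ↔ S ≤ T
    constructor
    · intro h
      by_contra hn
      obtain ⟨p, m, q, n, hp, hq, h1, h2⟩ :=
        JTensor.exists_primePair (primeSeparated C) (primeSeparated D) hn
      exact (omegaFun_le hp hq S).1 (h.trans ((omegaFun_le hp hq T).2 h2)) h1
    · intro h
      exact iSup₂_le fun x hx => le_iSup₂_of_le x (h hx) le_rfl

end Omega


end Tensor

/-! ### Algebraic completely distributive lattices, comonoids and derivation lattices -/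

/-- Algebraic completely distributive lattices. -/
structure ACDL : Type (u + 1) where
  carrier : Type u
  [completelyDistrib : CompletelyDistribLattice carrier]
  [algebraic : IsCompactlyGenerated carrier]

attribute [instance] ACDL.completelyDistrib ACDL.algebraic

instance : CoeSort ACDL.{u} (Type u) := ⟨ACDL.carrier⟩

/-- Comonoid structures on an algebraic completely distributive lattice `C`: a comultiplication
`C → C ⊠ C` and a counit `C → 2`, both preserving all meets and all joins, subject to
coassociativity and the counit laws. The lattice `C ⊠ C` represents the coproduct of `C` with
itself, so preservation of joins by the comultiplication is purity. -/
@[ext]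
structure ComonoidStr (C : Type u) [CompletelyDistribLattice C] where
  comul : CompleteLatticeHom C (MTensor C C)
  counit : CompleteLatticeHom C Prop
  coassoc : ∀ x, MTensor.assoc C C C (MTensor.map comul.tosInfHom (sInfHom.id C) (comul x)) =
    MTensor.map (sInfHom.id C) comul.tosInfHom (comul x)
  counit_left : ∀ x,
    MTensor.leftUnitor C (MTensor.map counit.tosInfHom (sInfHom.id C) (comul x)) = x
  counit_right : ∀ x,
    MTensor.rightUnitor C (MTensor.map (sInfHom.id C) counit.tosInfHom (comul x)) = x

/-- The comultiplication with values in the tensor product of complete join-semilattices. -/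
def ComonoidStr.joinComul {C : Type u} [CompletelyDistribLattice C] [IsCompactlyGenerated C]
    (s : ComonoidStr C) (x : C) : JTensor C C := (omega C C).symm (s.comul x)

/-- Comonoids in algebraic completely distributive lattices, with pure morphisms. -/
structure Comon : Type (u + 1) where
  toACDL : ACDL.{u}
  str : ComonoidStr toACDL

/-- Pure morphisms of comonoids. -/
@[ext]
structure Comon.Hom (C D : Comon.{u}) where
  hom : CompleteLatticeHom C.toACDL D.toACDL
  map_comul : ∀ x, MTensor.map hom.tosInfHom hom.tosInfHom (C.str.comul x) = D.str.comul (hom x)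
  map_counit : ∀ x, C.str.counit x = D.str.counit (hom x)

instance : Category Comon.{u} where
  Hom := Comon.Hom
  id C := ⟨CompleteLatticeHom.id _, fun x => DFunLike.congr_fun MTensor.map_id _, fun _ => rfl⟩
  comp {C D E} f g := ⟨g.hom.comp f.hom,
    fun x => by
      change MTensor.map (g.hom.tosInfHom.comp f.hom.tosInfHom)
        (g.hom.tosInfHom.comp f.hom.tosInfHom) _ = E.str.comul (g.hom (f.hom x))
      rw [MTensor.map_comp, ← g.map_comul, ← f.map_comul]; rfl,
    fun x => (f.map_counit x).trans (g.map_counit _)⟩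

/-- Comonoids in algebraic completely distributive lattices, with corelational morphisms. -/
structure RelComon : Type (u + 1) where
  toComon : Comon.{u}

/-- Corelational morphisms of comonoids. -/
@[ext]
structure RelComon.Hom (C D : RelComon.{u}) where
  hom : sSupHom C.toComon.toACDL D.toComon.toACDL
  map_top : hom ⊤ = ⊤
  map_comul_le : ∀ x, JTensor.map hom hom (C.toComon.str.joinComul x) ≤
    D.toComon.str.joinComul (hom x)
  map_counit_le : ∀ x, C.toComon.str.counit x ≤ D.toComon.str.counit (hom x)

instance : Category RelComon.{u} where
  Hom := RelComon.Hom
  id C := ⟨sSupHom.id _, rfl, fun x => (DFunLike.congr_fun JTensor.map_id _).le, fun _ => le_rfl⟩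
  comp {C D E} f g := ⟨g.hom.comp f.hom, by simp [f.map_top, g.map_top],
    fun x => by
      rw [JTensor.map_comp]
      exact (OrderHomClass.mono (JTensor.map g.hom g.hom) (f.map_comul_le x)).trans
        (g.map_comul_le _),
    fun x => (f.map_counit_le x).trans (g.map_counit_le _)⟩

/-- Residuation structures on a complete lattice `R`: the residuals `lres x z = x \ z` and
`rres z y = z / y` preserve all meets in both variables as maps `Rᵒᵈ × R → R` and
`R × Rᵒᵈ → R`, and satisfy the residuation property. -/
@[ext]
structure ResiduationStr (R : Type u) [CompletelyDistribLattice R] where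
  lres : R → R → R
  rres : R → R → R
  lres_sSup : ∀ (A : Set R) (z : R), lres (sSup A) z = ⨅ a ∈ A, lres a z
  lres_sInf : ∀ (x : R) (A : Set R), lres x (sInf A) = ⨅ a ∈ A, lres x a
  rres_sInf : ∀ (A : Set R) (y : R), rres (sInf A) y = ⨅ a ∈ A, rres a y
  rres_sSup : ∀ (z : R) (A : Set R), rres z (sSup A) = ⨅ a ∈ A, rres z a
  residuation : ∀ a b c : R, b ≤ lres a c ↔ a ≤ rres c b

/-- Derivation structures: residuation structures that are associative, unital with a completely
join-prime unit, and pure. -/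
@[ext]
structure DerivationStr (R : Type u) [CompletelyDistribLattice R] extends ResiduationStr R where
  unit : R
  unit_prime : IsCompletelyJoinPrime unit
  unit_lres : ∀ z, lres unit z = z
  rres_unit : ∀ z, rres z unit = z
  assoc : ∀ x y z, lres x (rres z y) = rres (lres x z) y
  pure_lres : ∀ (p : R) (A : Set R), IsCompletelyJoinPrime p →
    lres p (sSup A) = ⨆ a ∈ A, lres p a
  pure_rres : ∀ (p : R) (A : Set R), IsCompletelyJoinPrime p →
    rres (sSup A) p = ⨆ a ∈ A, rres a p

/-- Derivation algebraic completely distributive lattices, with residuation morphisms. -/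
structure DerACDL : Type (u + 1) where
  toACDL : ACDL.{u}
  str : DerivationStr toACDL

/-- Residuation morphisms: complete lattice morphisms satisfying the forth, back and unit
conditions. -/
@[ext]
structure DerACDL.Hom (R S : DerACDL.{u}) where
  hom : CompleteLatticeHom R.toACDL S.toACDL
  forth_lres : ∀ x z, hom (R.str.lres x z) ≤ S.str.lres (hom x) (hom z)
  forth_rres : ∀ x z, hom (R.str.rres z x) ≤ S.str.rres (hom z) (hom x)
  back_lres : ∀ y z, ∃ x, y ≤ hom x ∧ S.str.lres y (hom z) = hom (R.str.lres x z)
  back_rres : ∀ y z, ∃ x, y ≤ hom x ∧ S.str.rres (hom z) y = hom (R.str.rres z x)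
  unit_le_iff : ∀ x, R.str.unit ≤ x ↔ S.str.unit ≤ hom x

instance : Category DerACDL.{u} where
  Hom := DerACDL.Hom
  id R := ⟨CompleteLatticeHom.id _, fun _ _ => le_rfl, fun _ _ => le_rfl,
    fun y _ => ⟨y, le_rfl, rfl⟩, fun y _ => ⟨y, le_rfl, rfl⟩, fun _ => Iff.rfl⟩
  comp {R S T} f g := ⟨g.hom.comp f.hom,
    fun x z => (OrderHomClass.mono g.hom (f.forth_lres x z)).trans (g.forth_lres _ _),
    fun x z => (OrderHomClass.mono g.hom (f.forth_rres x z)).trans (g.forth_rres _ _),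
    fun y z => by
      obtain ⟨s, hs, hs'⟩ := g.back_lres y (f.hom z)
      obtain ⟨x, hx, hx'⟩ := f.back_lres s z
      exact ⟨x, hs.trans (OrderHomClass.mono g.hom hx), hs'.trans (congrArg g.hom hx')⟩,
    fun y z => by
      obtain ⟨s, hs, hs'⟩ := g.back_rres y (f.hom z)
      obtain ⟨x, hx, hx'⟩ := f.back_rres s z
      exact ⟨x, hs.trans (OrderHomClass.mono g.hom hx), hs'.trans (congrArg g.hom hx')⟩,
    fun x => (f.unit_le_iff x).trans (g.unit_le_iff _)⟩

/-- Derivation algebraic completely distributive lattices, with corelational morphisms. -/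
structure RelDerACDL : Type (u + 1) where
  toDerACDL : DerACDL.{u}

/-- Corelational residuation morphisms. -/
@[ext]
structure RelDerACDL.Hom (R S : RelDerACDL.{u}) where
  hom : sSupHom R.toDerACDL.toACDL S.toDerACDL.toACDL
  map_top : hom ⊤ = ⊤
  lres_le : ∀ x z, hom (R.toDerACDL.str.lres x z) ≤ S.toDerACDL.str.lres (hom x) (hom z)
  unit_le : S.toDerACDL.str.unit ≤ hom R.toDerACDL.str.unit

instance : Category RelDerACDL.{u} where
  Hom := RelDerACDL.Hom
  id R := ⟨sSupHom.id _, rfl, fun _ _ => le_rfl, le_rfl⟩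
  comp f g := ⟨g.hom.comp f.hom, by simp [f.map_top, g.map_top],
    fun x z => (OrderHomClass.mono g.hom (f.lres_le x z)).trans (g.lres_le _ _),
    g.unit_le.trans (OrderHomClass.mono g.hom f.unit_le)⟩

/-! ### Ordered monoids -/

/-- Ordered monoids: monoids with a partial order such that multiplication is monotone in both
arguments. -/
structure OrdMon : Type (u + 1) where
  carrier : Type u
  [monoid : Monoid carrier]
  [partialOrder : PartialOrder carrier]
  [mulLeftMono : MulLeftMono carrier]
  [mulRightMono : MulRightMono carrier]

attribute [instance] OrdMon.monoid OrdMon.partialOrder OrdMon.mulLeftMono OrdMon.mulRightMono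

instance : CoeSort OrdMon.{u} (Type u) := ⟨OrdMon.carrier⟩

/-- Ordered monoids with monotone monoid homomorphisms. -/
instance : Category OrdMon.{u} where
  Hom M N := M →*o N
  id M := OrderMonoidHom.id M
  comp f g := g.comp f

/-- Ordered monoids, with relational morphisms. -/
structure RelOrdMon : Type (u + 1) where
  toOrdMon : OrdMon.{u}

/-- Relational morphisms of ordered monoids: total order relations `M → 𝒟⁺ N`, where `𝒟 N` is the
poset of downsets of `N`, with `ρ(x) ρ(y) ⊆ ρ(x y)` and `1 ∈ ρ(1)`. -/
@[ext]
structure RelOrdMon.Hom (M N : RelOrdMon.{u}) where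
  rel : M.toOrdMon →o LowerSet N.toOrdMon
  total : ∀ x, ∃ n, n ∈ rel x
  mul_mem : ∀ x y, ∀ n ∈ rel x, ∀ n' ∈ rel y, n * n' ∈ rel (x * y)
  one_mem : 1 ∈ rel 1

/-- Relational morphisms are composed as relations; the identity is `x ↦ {y | y ≤ x}`. -/
instance : Category RelOrdMon.{u} where
  Hom := RelOrdMon.Hom
  id M :=
    { rel := ⟨fun x => LowerSet.Iic x, fun _ _ h => LowerSet.Iic_le.2 (by simpa using h)⟩
      total := fun x => ⟨x, le_refl x⟩
      mul_mem := fun _ _ _ hn _ hn' => mul_le_mul' hn hn'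
      one_mem := le_refl 1 }
  comp {M N P} f g :=
    { rel :=
        { toFun := fun x => ⨆ n ∈ f.rel x, g.rel n
          monotone' := fun x y h => iSup₂_le fun n hn =>
            le_iSup₂_of_le n (f.rel.monotone h hn) le_rfl }
      total := fun x => by
        obtain ⟨n, hn⟩ := f.total x
        obtain ⟨p, hp⟩ := g.total n
        exact ⟨p, LowerSet.mem_iSup₂_iff.2 ⟨n, hn, hp⟩⟩
      mul_mem := fun x y p hp p' hp' => by
        obtain ⟨n, hn, hp⟩ := LowerSet.mem_iSup₂_iff.1 hp
        obtain ⟨n', hn', hp'⟩ := LowerSet.mem_iSup₂_iff.1 hp'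
        exact LowerSet.mem_iSup₂_iff.2
          ⟨n * n', f.mul_mem x y n hn n' hn', g.mul_mem n n' p hp p' hp'⟩
      one_mem := LowerSet.mem_iSup₂_iff.2 ⟨1, f.one_mem, g.one_mem⟩ }
  id_comp f := by
    apply RelOrdMon.Hom.ext
    ext x p
    change p ∈ (⨆ n ∈ LowerSet.Iic x, f.rel n) ↔ p ∈ f.rel x
    rw [LowerSet.mem_iSup₂_iff]
    exact ⟨fun ⟨n, hn, hp⟩ => f.rel.monotone hn hp, fun hp => ⟨x, le_refl x, hp⟩⟩
  comp_id {M N} f := by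
    apply RelOrdMon.Hom.ext
    ext x p
    change p ∈ (⨆ n ∈ f.rel x, LowerSet.Iic n) ↔ p ∈ f.rel x
    rw [LowerSet.mem_iSup₂_iff]
    exact ⟨fun ⟨n, hn, hp⟩ => (f.rel x).lower hp hn, fun hp => ⟨p, hp, le_refl p⟩⟩
  assoc f g h := by
    apply RelOrdMon.Hom.ext
    ext x p
    change p ∈ (⨆ m ∈ (⨆ n ∈ f.rel x, g.rel n), h.rel m) ↔
      p ∈ (⨆ n ∈ f.rel x, ⨆ m ∈ g.rel n, h.rel m)
    simp only [LowerSet.mem_iSup₂_iff]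
    exact ⟨fun ⟨m, ⟨n, hn, hm⟩, hp⟩ => ⟨n, hn, m, hm, hp⟩,
      fun ⟨n, hn, m, hm, hp⟩ => ⟨m, ⟨n, hn, hm⟩, hp⟩⟩

/-! ### Full subcategories on finite carriers -/

def OrdMon.finite : ObjectProperty OrdMon.{u} := fun M => Finite M

def RelOrdMon.finite : ObjectProperty RelOrdMon.{u} := fun M => Finite M.toOrdMon

def Comon.finite : ObjectProperty Comon.{u} := fun C => Finite C.toACDL

def RelComon.finite : ObjectProperty RelComon.{u} := fun C => Finite C.toComon.toACDL

def DerACDL.finite : ObjectProperty DerACDL.{u} := fun R => Finite R.toACDL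

def RelDerACDL.finite : ObjectProperty RelDerACDL.{u} := fun R => Finite R.toDerACDL.toACDL

/-- The dual equivalence `E` restricts to a dual equivalence of the full subcategories on the
objects satisfying `P` and `Q`. -/
def RestrictsDualEquiv {A : Type v} [Category.{u} A] {B : Type w} [Category.{u} B]
    (E : Aᵒᵖ ≌ B) (P : ObjectProperty A) (Q : ObjectProperty B) : Prop :=
  ∃ E' : P.FullSubcategoryᵒᵖ ≌ Q.FullSubcategory, Nonempty (E'.functor ⋙ Q.ι ≅ P.ι.op ⋙ E.functor)

/-- The isomorphism of categories `I` restricts to an isomorphism of the full subcategories on the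
objects satisfying `P` and `Q`. -/
def RestrictsIso {A B : Type v} [Category.{u} A] [Category.{u} B]
    (I : Cat.of A ≅ Cat.of B) (P : ObjectProperty A) (Q : ObjectProperty B) : Prop :=
  ∃ I' : Cat.of P.FullSubcategory ≅ Cat.of Q.FullSubcategory,
    I'.hom.toFunctor ⋙ Q.ι = P.ι ⋙ I.hom.toFunctor

end OrdDual

open OrdDual

namespace OrdDual

/-! ### Completely join-prime elements -/

section Prime

variable {α β : Type*} [CompleteLattice α] [CompleteLattice β]

/-! In an algebraic completely distributive lattice every element is the join of the completely
join-prime elements below it, and each prime `p` is paired with a completely meet-prime `m`, so that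
`p ≤ z` exactly when `z ≤ m` fails. The same holds in tensor products: `p ⊗ q` is prime, `m ⊠ n` is
meet-prime, and `omega` matches `p ⊗ q ≤ T` with the failure of `omega T ≤ m ⊠ n`. Identities and
inequalities can therefore be tested on primes.

Comonoids and derivation lattices are two presentations of one structure: an associative unital
product that preserves joins in each variable, with a prime unit and with products of primes prime.
The comultiplication encodes it by `a ⊗ b ≤ γ z ↔ a b ≤ z` (`IsProductOf`), the residuals by `b ≤ a
\ z ↔ a b ≤ z ↔ a ≤ z / b`. Primality of products of primes corresponds to the comultiplication
preserving joins on one side and to purity of the residuals on the other. A lattice morphism is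
pure, or a residuation morphism, exactly when its left adjoint preserves products and unit
(`map_comul_iff`, `residuation_conditions_iff`). The corelational conditions on both sides reduce to
`f a * f b ≤ f (a * b)` and a unit inequality. This gives isomorphisms of categories, not merely
equivalences.

For the dualities, the primes of a derivation lattice form an ordered monoid, and the lattice is the
lattice of downsets of its primes. Left adjoints of lattice morphisms preserve primes, so
residuation morphisms are exactly preimage maps of monotone homomorphisms. In the relational case
the preimage of an upset under a relational morphism is again an upset, so the opposite order is
used; a join-preserving map is determined by its values on principal upsets, and these values form
the relation. A poset is finite exactly when its lattice of downsets is, hence the restriction to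
finite objects. -/

theorem IsPrimePair.isCompletelyJoinPrime {p m : α} (h : IsPrimePair p m) :
    IsCompletelyJoinPrime p := by
  intro A hA
  by_contra! hc
  exact (h _).1 hA (sSup_le fun a ha => by_contra fun ham => hc a ha ((h a).2 ham))

/-- Primality says precisely that the join of all elements not above `p` is still not above `p`. -/
theorem IsCompletelyJoinPrime.isPrimePair {p : α} (h : IsCompletelyJoinPrime p) :
    IsPrimePair p (sSup {z | ¬ p ≤ z}) := by
  refine fun z => ⟨fun hz hle => ?_, fun hz => by_contra fun hpz => hz (le_sSup hpz)⟩
  obtain ⟨a, ha, hpa⟩ := h _ (hz.trans hle)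
  exact ha hpa

theorem IsPrimePair.le_iff {p m : α} (h : IsPrimePair p m) {z : α} : z ≤ m ↔ ¬ p ≤ z := by
  rw [h z, not_not]

/-- This is complete meet-primeness of `m`. It evaluates maps out of `⊠`, which are infima over
pairs, because a single pair then decides the inequality. -/
theorem IsPrimePair.iInf_le_iff {p m : α} (h : IsPrimePair p m) {ι : Type*} (s : Set ι)
    (f : ι → α) : ⨅ i ∈ s, f i ≤ m ↔ ∃ i ∈ s, f i ≤ m := by
  simp only [h.le_iff, le_iInf_iff, not_forall, exists_prop]

theorem PrimeSeparated.le_iff (h : PrimeSeparated α) {x y : α} :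
    x ≤ y ↔ ∀ p, IsCompletelyJoinPrime p → p ≤ x → p ≤ y := by
  refine ⟨fun hxy p _ hp => hp.trans hxy, fun hxy => by_contra fun hn => ?_⟩
  obtain ⟨p, m, hpm, h1, h2⟩ := h x y hn
  exact (hpm y).1 (hxy p hpm.isCompletelyJoinPrime h1) h2

theorem PrimeSeparated.sSup_prime_eq (h : PrimeSeparated α) (x : α) :
    sSup {p | IsCompletelyJoinPrime p ∧ p ≤ x} = x :=
  le_antisymm (sSup_le fun _ hp => hp.2) (h.le_iff.2 fun _ hp hpx => le_sSup ⟨hp, hpx⟩)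

/-- The left adjoint of a map preserving all meets. -/
def leftAdj (f : α → β) (b : β) : α := sInf {x | b ≤ f x}

theorem leftAdj_le_iff {f : α → β} (hf : ∀ A, f (sInf A) = ⨅ a ∈ A, f a) {b : β} {x : α} :
    leftAdj f b ≤ x ↔ b ≤ f x := by
  -- Monotonicity follows from preservation of the meet of `{y, z}`.
  have hmono : Monotone f := fun y z hyz => by
    have := hf {y, z}
    rw [sInf_pair, inf_eq_left.2 hyz] at this
    rw [this]
    exact iInf₂_le z (by simp)
  refine ⟨fun h => le_trans ?_ (hmono h), fun h => sInf_le h⟩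
  rw [leftAdj, hf]
  exact le_iInf₂ fun _ ha => ha

theorem leftAdj_hom_le_iff (f : CompleteLatticeHom α β) {b : β} {x : α} :
    leftAdj f b ≤ x ↔ b ≤ f x :=
  leftAdj_le_iff fun A => by rw [map_sInf, sInf_image]

/-- Since `f` preserves joins, `p ≤ f (⋁ A)` puts `p` below some `f a`. Through this lemma lattice
morphisms act contravariantly on primes. -/
theorem IsCompletelyJoinPrime.leftAdj (f : CompleteLatticeHom α β) {p : β}
    (hp : IsCompletelyJoinPrime p) : IsCompletelyJoinPrime (leftAdj f p) := by
  intro A hA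
  rw [leftAdj_hom_le_iff, map_sSup] at hA
  obtain ⟨_, ⟨a, ha, rfl⟩, h⟩ := hp _ hA
  exact ⟨a, ha, (leftAdj_hom_le_iff f).2 h⟩

end Prime

/-! ### Prime elements of tensor products -/

namespace MTensor

variable {J J' K K' L L' : Type*} [CompleteLattice J] [CompleteLattice K] [CompleteLattice L]
  [CompleteLattice J'] [CompleteLattice K'] [CompleteLattice L']

theorem primeSeparated (hJ : PrimeSeparated J) (hK : PrimeSeparated K) :
    PrimeSeparated (MTensor J K) := by
  intro S T h
  obtain ⟨p, m, q, n, hp, hq, h1, h2⟩ := exists_primePair hJ hK h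
  exact ⟨_, _, isPrimePair hp hq, ((isPrimePair hp hq) S).2 h1, h2⟩

/-- For general `m` and `n` this fails, because a pure tensor with a factor `⊤` is itself `⊤`; here
the prime `(p ⊠ ⊥) ⊓ (⊥ ⊠ q)` separates. -/
theorem tmul_le_tmul_iff {p m j : J} {q n k : K} (hp : IsPrimePair p m) (hq : IsPrimePair q n) :
    tmul j k ≤ tmul m n ↔ j ≤ m ∧ k ≤ n := by
  refine ⟨fun h => ?_, fun h => tmul_mono h.1 h.2⟩
  rw [(isPrimePair hp hq).le_iff] at h
  constructor <;> by_contra hc <;> apply h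
  · exact inf_le_left.trans (tmul_mono ((hp j).2 hc) bot_le)
  · exact inf_le_right.trans (tmul_mono bot_le ((hq k).2 hc))

theorem map_apply (f : sInfHom J J') (g : sInfHom K K') (S : MTensor J K) :
    map f g S = ⨅ x ∈ S.pairs, tmul (f x.1) (g x.2) := lift_apply _ _ _

/-- By meet-primeness of `m' ⊠ n'`, one pair `(j, k)` with `S ≤ j ⊠ k` has image below it. The
hypotheses make `m` and `n` the largest elements sent below `m'` and `n'`. -/
theorem map_le_tmul_iff (f : sInfHom J J') (g : sInfHom K K') {p' m' : J'} {q' n' : K'} {m : J}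
    {n : K} (hp : IsPrimePair p' m') (hq : IsPrimePair q' n') (hm : ∀ j, f j ≤ m' ↔ j ≤ m)
    (hn : ∀ k, g k ≤ n' ↔ k ≤ n) (S : MTensor J K) :
    map f g S ≤ tmul m' n' ↔ S ≤ tmul m n := by
  rw [map_apply, (isPrimePair hp hq).iInf_le_iff]
  simp only [tmul_le_tmul_iff hp hq, hm, hn]
  exact ⟨fun ⟨x, hx, h⟩ => le_trans hx (tmul_mono h.1 h.2), fun h => ⟨(m, n), h, le_rfl, le_rfl⟩⟩

theorem assoc_apply (S : MTensor (MTensor J K) L) :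
    assoc J K L S = ⨅ x ∈ S.pairs, ⨅ y ∈ x.1.pairs, tmul y.1 (tmul y.2 x.2) := by
  simp only [assoc, lift_apply]

theorem assoc_le_tmul_iff {p m : J} {q n : K} {r l : L} (hp : IsPrimePair p m)
    (hq : IsPrimePair q n) (hr : IsPrimePair r l) (S : MTensor (MTensor J K) L) :
    assoc J K L S ≤ tmul m (tmul n l) ↔ S ≤ tmul (tmul m n) l := by
  have hqr := isPrimePair hq hr
  constructor
  · rw [assoc_apply, (isPrimePair hp hqr).iInf_le_iff]
    rintro ⟨x, hx, h⟩
    rw [(isPrimePair hp hqr).iInf_le_iff] at h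
    obtain ⟨y, hy, h⟩ := h
    rw [tmul_le_tmul_iff hp hqr, tmul_le_tmul_iff hq hr] at h
    exact le_trans hx (tmul_mono (le_trans hy (tmul_mono h.1 h.2.1)) h.2.2)
  · intro h
    rw [← assoc_tmul]
    exact OrderHomClass.mono _ h

theorem eq_of_le_tmul_iff (hJ : PrimeSeparated J) (hK : PrimeSeparated K) {S T : MTensor J K}
    (h : ∀ p m q n, IsPrimePair p m → IsPrimePair q n → (S ≤ tmul m n ↔ T ≤ tmul m n)) :
    S = T := by
  apply le_antisymm <;> by_contra hc
  · obtain ⟨p, m, q, n, hp, hq, h1, h2⟩ := exists_primePair hJ hK hc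
    exact h1 ((h p m q n hp hq).2 h2)
  · obtain ⟨p, m, q, n, hp, hq, h1, h2⟩ := exists_primePair hJ hK hc
    exact h1 ((h p m q n hp hq).1 h2)

/-- Triple pure tensors of meet-primes suffice as tests: a meet-prime of `K ⊠ L` is itself a pure
tensor of meet-primes. -/
theorem le_of_le_tmul₃ (hJ : PrimeSeparated J) (hK : PrimeSeparated K) (hL : PrimeSeparated L)
    {S T : MTensor J (MTensor K L)}
    (h : ∀ p m q n r l, IsPrimePair p m → IsPrimePair q n → IsPrimePair r l →
      T ≤ tmul m (tmul n l) → S ≤ tmul m (tmul n l)) : S ≤ T := by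
  by_contra hc
  obtain ⟨p, m, Q, N, hp, hQ, h1, h2⟩ := exists_primePair hJ (primeSeparated hK hL) hc
  obtain ⟨P', m', q, n, hm, hn, h3, h4⟩ := exists_primePair hK hL (fun h => (hQ N).1 h le_rfl)
  -- `N` is the largest element not above `Q`, and `m' ⊠ n` lies above `N` but not above `Q`.
  have h4' : N = tmul m' n := by
    refine le_antisymm h4 (hQ.le_iff.2 fun h => h3 h)
  subst h4'
  exact h1 (h _ _ _ _ _ _ hp hm hn h2)

theorem eq_of_le_tmul₃_iff (hJ : PrimeSeparated J) (hK : PrimeSeparated K) (hL : PrimeSeparated L)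
    {S T : MTensor J (MTensor K L)}
    (h : ∀ p m q n r l, IsPrimePair p m → IsPrimePair q n → IsPrimePair r l →
      (S ≤ tmul m (tmul n l) ↔ T ≤ tmul m (tmul n l))) : S = T :=
  le_antisymm
    (le_of_le_tmul₃ hJ hK hL fun _ _ _ _ _ _ hp hq hr => (h _ _ _ _ _ _ hp hq hr).2)
    (le_of_le_tmul₃ hJ hK hL fun _ _ _ _ _ _ hp hq hr => (h _ _ _ _ _ _ hp hq hr).1)

/-- Primality of `q` enters only through `n ≠ ⊤`. -/
theorem join_prop_le_iff {q n k : K} (hq : IsPrimePair q n) {b : Prop} :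
    (⨆ _ : b, (⊤ : K)) ⊔ k ≤ n ↔ ¬ b ∧ k ≤ n := by
  rw [sup_le_iff, iSup_le_iff]
  exact and_congr_left' (forall_congr' fun _ => iff_false_intro ((hq ⊤).1 le_top))

/-- The counit is the indicator of the elements above `e`, so it vanishes exactly below the partner
`m` of `e`. The counit law is thereby tested at `m ⊠ n`. -/
theorem leftUnitor_map_le_iff {q n : K} {ε : CompleteLatticeHom J Prop} {e m : J}
    (he : ∀ x, ε x ↔ e ≤ x) (hm : IsPrimePair e m) (hq : IsPrimePair q n) (S : MTensor J K) :
    leftUnitor K (map ε.tosInfHom (sInfHom.id K) S) ≤ n ↔ S ≤ tmul m n := by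
  have : leftUnitor K (map ε.tosInfHom (sInfHom.id K) S) =
      ⨅ x ∈ S.pairs, ((⨆ _ : ε x.1, (⊤ : K)) ⊔ x.2) := by
    rw [map_apply]
    simp only [map_iInf]
    exact iInf_congr fun x => iInf_congr fun _ => lift_tmul _ _ _ _
  rw [this, hq.iInf_le_iff]
  simp only [join_prop_le_iff hq, he, ← hm.le_iff]
  exact ⟨fun ⟨x, hx, h⟩ => le_trans hx (tmul_mono h.1 h.2), fun h => ⟨(m, n), h, le_rfl, le_rfl⟩⟩

theorem rightUnitor_map_le_iff {q n : J} {ε : CompleteLatticeHom K Prop} {e m : K}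
    (he : ∀ x, ε x ↔ e ≤ x) (hm : IsPrimePair e m) (hq : IsPrimePair q n) (S : MTensor J K) :
    rightUnitor J (map (sInfHom.id J) ε.tosInfHom S) ≤ n ↔ S ≤ tmul n m := by
  have : rightUnitor J (map (sInfHom.id J) ε.tosInfHom S) =
      ⨅ x ∈ S.pairs, ((⨆ _ : ε x.2, (⊤ : J)) ⊔ x.1) := by
    rw [map_apply]
    simp only [map_iInf]
    exact iInf_congr fun x => iInf_congr fun _ => lift_tmul _ _ _ _
  rw [this, hq.iInf_le_iff]
  simp only [join_prop_le_iff hq, he, ← hm.le_iff]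
  exact ⟨fun ⟨x, hx, h⟩ => le_trans hx (tmul_mono h.2 h.1), fun h => ⟨(n, m), h, le_rfl, le_rfl⟩⟩

end MTensor

/-! ### Comultiplications and products -/

section Product

variable {C D : Type*} [CompletelyDistribLattice C] [IsCompactlyGenerated C]
  [CompletelyDistribLattice D] [IsCompactlyGenerated D]

theorem forall_prime_le_iff (α : Type*) [CompletelyDistribLattice α] [IsCompactlyGenerated α]
    {x y : α} : x ≤ y ↔ ∀ p, IsCompletelyJoinPrime p → p ≤ x → p ≤ y :=
  (primeSeparated α).le_iff

/-- `mul` is the product corresponding to the comultiplication `comul`. -/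
def IsProductOf (mul : C → C → C) (comul : C → MTensor C C) : Prop :=
  ∀ a b z, JTensor.tmul a b ≤ (omega C C).symm (comul z) ↔ mul a b ≤ z

/-- The product corresponding to a comultiplication. -/
def productOf (comul : C → MTensor C C) (a b : C) : C :=
  sInf {z | JTensor.tmul a b ≤ (omega C C).symm (comul z)}

theorem isProductOf_productOf (comul : CompleteLatticeHom C (MTensor C C)) :
    IsProductOf (productOf comul) comul := fun a b z =>
  (leftAdj_le_iff (f := fun z => (omega C C).symm (comul z)) (fun A => by
    simp only [map_sInf, sInf_image, OrderIso.map_iInf])).symm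

end Product

namespace IsProductOf

section

variable {C : Type*} [CompletelyDistribLattice C] [IsCompactlyGenerated C] {mul : C → C → C}

/-- Joint join-preservation of the product is the closure condition `sSup_mem` satisfied by every
element of the tensor product. -/
theorem sSup_le_iff {comul : C → MTensor C C} (h : IsProductOf mul comul) (A B : Set C) (z : C) :
    mul (sSup A) (sSup B) ≤ z ↔ ∀ a ∈ A, ∀ b ∈ B, mul a b ≤ z := by
  simp only [← h _ _ z, JTensor.tmul_le_iff]
  exact ⟨fun hz a ha b hb => ((omega C C).symm (comul z)).lower
    (show (a, b) ≤ (sSup A, sSup B) from ⟨le_sSup ha, le_sSup hb⟩) hz, JTensor.sSup_mem _ A B⟩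

theorem le_iff_forall_prime {comul : C → MTensor C C} (h : IsProductOf mul comul) {a b z : C} :
    mul a b ≤ z ↔ ∀ p, IsCompletelyJoinPrime p → p ≤ a → ∀ q, IsCompletelyJoinPrime q → q ≤ b →
      mul p q ≤ z := by
  have := h.sSup_le_iff {p | IsCompletelyJoinPrime p ∧ p ≤ a} {p | IsCompletelyJoinPrime p ∧ p ≤ b} z
  simp only [(primeSeparated C).sSup_prime_eq] at this
  rw [this]
  exact ⟨fun h p hp hpa q hq hqb => h p ⟨hp, hpa⟩ q ⟨hq, hqb⟩,
    fun h p hp q hq => h p hp.1 hp.2 q hq.1 hq.2⟩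

theorem mono {comul : C → MTensor C C} (h : IsProductOf mul comul) {a a' b b' : C}
    (ha : a ≤ a') (hb : b ≤ b') : mul a b ≤ mul a' b' :=
  (h _ _ _).1 ((JTensor.tmul_mono ha hb).trans ((h _ _ _).2 le_rfl))

theorem sSup_left_le_iff {comul : C → MTensor C C} (h : IsProductOf mul comul) (A : Set C)
    (b z : C) : mul (sSup A) b ≤ z ↔ ∀ a ∈ A, mul a b ≤ z := by
  simpa using h.sSup_le_iff A {b} z

theorem sSup_right_le_iff {comul : C → MTensor C C} (h : IsProductOf mul comul) (a : C)
    (B : Set C) (z : C) : mul a (sSup B) ≤ z ↔ ∀ b ∈ B, mul a b ≤ z := by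
  simpa using h.sSup_le_iff {a} B z

variable {comul : CompleteLatticeHom C (MTensor C C)}

theorem unique {mul' : C → C → C} (h : IsProductOf mul comul) (h' : IsProductOf mul' comul) :
    mul = mul' :=
  funext₂ fun a b => eq_of_forall_ge_iff fun z => (h a b z).symm.trans (h' a b z)

/-- The dictionary between the two tensor products: `omega` exchanges testing from below by `p ⊗ q`
with testing from above by `m ⊠ n`. -/
theorem comul_le_tmul_iff (h : IsProductOf mul comul) {p m q n : C} (hp : IsPrimePair p m)
    (hq : IsPrimePair q n) (z : C) : comul z ≤ MTensor.tmul m n ↔ ¬ mul p q ≤ z := by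
  rw [← h, ← omegaFun_le hp hq]
  change _ ↔ omega C C ((omega C C).symm (comul z)) ≤ _
  rw [OrderIso.apply_symm_apply]

theorem comul_unique (h : IsProductOf mul comul) {comul' : CompleteLatticeHom C (MTensor C C)}
    (h' : IsProductOf mul comul') : comul = comul' :=
  DFunLike.ext _ _ fun z => MTensor.eq_of_le_tmul_iff (primeSeparated C) (primeSeparated C)
    fun _ _ _ _ hp hq => by rw [h.comul_le_tmul_iff hp hq, h'.comul_le_tmul_iff hp hq]

/-- `p ⊗ q` is prime in the tensor product, and the comultiplication preserves joins. -/
theorem prime (h : IsProductOf mul comul) {p q : C} (hp : IsCompletelyJoinPrime p)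
    (hq : IsCompletelyJoinPrime q) : IsCompletelyJoinPrime (mul p q) := by
  intro A hA
  rw [← h, map_sSup, OrderIso.map_sSup, ← sSup_image, ← Set.image_comp] at hA
  obtain ⟨_, ⟨a, ha, rfl⟩, hpq⟩ :=
    (JTensor.isPrimePair hp.isPrimePair hq.isPrimePair).isCompletelyJoinPrime _ hA
  exact ⟨a, ha, (h _ _ _).1 hpq⟩

theorem coassoc_iff_prime (h : IsProductOf mul comul) (x : C) :
    MTensor.assoc C C C (MTensor.map comul.tosInfHom (sInfHom.id C) (comul x)) =
      MTensor.map (sInfHom.id C) comul.tosInfHom (comul x) ↔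
    ∀ p q r, IsCompletelyJoinPrime p → IsCompletelyJoinPrime q → IsCompletelyJoinPrime r →
      (mul (mul p q) r ≤ x ↔ mul p (mul q r) ≤ x) := by
  have hC := primeSeparated C
  -- At `m ⊠ (n ⊠ l)` the two composites test the two bracketings of `p q r`. Primality of `p q` and
  -- `q r` supplies the meet-prime partners needed to apply the dictionary a second time.
  have key : ∀ p m q n r l : C, IsPrimePair p m → IsPrimePair q n → IsPrimePair r l →
      (MTensor.assoc C C C (MTensor.map comul.tosInfHom (sInfHom.id C) (comul x)) ≤
        MTensor.tmul m (MTensor.tmul n l) ↔ ¬ mul (mul p q) r ≤ x) ∧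
      (MTensor.map (sInfHom.id C) comul.tosInfHom (comul x) ≤
        MTensor.tmul m (MTensor.tmul n l) ↔ ¬ mul p (mul q r) ≤ x) := by
    intro p m q n r l hp hq hr
    have hpq := (h.prime hp.isCompletelyJoinPrime hq.isCompletelyJoinPrime).isPrimePair
    have hqr := (h.prime hq.isCompletelyJoinPrime hr.isCompletelyJoinPrime).isPrimePair
    constructor
    · rw [MTensor.assoc_le_tmul_iff hp hq hr, MTensor.map_le_tmul_iff _ _
        (MTensor.isPrimePair hp hq) hr (fun j => (h.comul_le_tmul_iff hp hq j).trans hpq.le_iff.symm)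
        (fun _ => Iff.rfl), h.comul_le_tmul_iff hpq hr]
    · rw [MTensor.map_le_tmul_iff _ _ hp (MTensor.isPrimePair hq hr) (fun _ => Iff.rfl)
        (fun j => (h.comul_le_tmul_iff hq hr j).trans hqr.le_iff.symm), h.comul_le_tmul_iff hp hqr]
  constructor
  · intro he p q r hp hq hr
    have := key _ _ _ _ _ _ hp.isPrimePair hq.isPrimePair hr.isPrimePair
    rw [he] at this
    exact not_iff_not.1 (this.1.symm.trans this.2)
  · intro he
    refine MTensor.eq_of_le_tmul₃_iff hC hC hC fun p m q n r l hp hq hr => ?_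
    obtain ⟨h1, h2⟩ := key p m q n r l hp hq hr
    rw [h1, h2, he p q r hp.isCompletelyJoinPrime hq.isCompletelyJoinPrime hr.isCompletelyJoinPrime]

/-- Associativity can be checked on completely join-prime elements. -/
theorem mul_assoc_of_prime (h : IsProductOf mul comul)
    (hm : ∀ p q r, IsCompletelyJoinPrime p → IsCompletelyJoinPrime q → IsCompletelyJoinPrime r →
      mul (mul p q) r = mul p (mul q r)) (a b c : C) : mul (mul a b) c = mul a (mul b c) := by
  refine eq_of_forall_ge_iff fun z => ?_
  constructor
  · intro hz
    rw [h.le_iff_forall_prime]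
    intro p hp hpa s hs hsbc
    refine (h.mono le_rfl hsbc).trans ?_
    -- The prime `s` below `b c` need not be a product of primes. Passing to the residual of `z` by
    -- `p` allows `b c` to be split over primes `q ≤ b`, `r ≤ c`.
    have : mul b c ≤ sSup {x | mul p x ≤ z} := by
      rw [h.le_iff_forall_prime]
      intro q hq hqb r hr hrc
      refine le_sSup ?_
      change mul p (mul q r) ≤ z
      rw [← hm p q r hp hq hr]
      exact (h.mono (h.mono hpa hqb) hrc).trans hz
    refine (h.mono le_rfl this).trans ?_
    rw [h.sSup_right_le_iff]
    exact fun _ hb => hb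
  · intro hz
    rw [h.le_iff_forall_prime]
    intro s hs hsab r hr hrc
    refine (h.mono hsab le_rfl).trans ?_
    have : mul a b ≤ sSup {x | mul x r ≤ z} := by
      rw [h.le_iff_forall_prime]
      intro p hp hpa q hq hqb
      refine le_sSup ?_
      change mul (mul p q) r ≤ z
      rw [hm p q r hp hq hr]
      exact (h.mono hpa (h.mono hqb hrc)).trans hz
    refine (h.mono this le_rfl).trans ?_
    rw [h.sSup_left_le_iff]
    exact fun _ hb => hb

theorem coassoc_iff (h : IsProductOf mul comul) :
    (∀ x, MTensor.assoc C C C (MTensor.map comul.tosInfHom (sInfHom.id C) (comul x)) =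
      MTensor.map (sInfHom.id C) comul.tosInfHom (comul x)) ↔
    ∀ a b c, mul (mul a b) c = mul a (mul b c) := by
  simp only [h.coassoc_iff_prime]
  constructor
  · exact fun hx => h.mul_assoc_of_prime fun p q r hp hq hr =>
      eq_of_forall_ge_iff fun x => hx x p q r hp hq hr
  · exact fun hm x p q r _ _ _ => by rw [hm]

variable {counit : CompleteLatticeHom C Prop} {e : C}

/-- Tested on a prime `q`, the unitor composite at `x` lies above `q` exactly when `e q ≤ x`; joins
of primes then give all elements. -/
theorem counit_left_iff (h : IsProductOf mul comul) (he : IsCompletelyJoinPrime e)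
    (hce : ∀ x, counit x ↔ e ≤ x) :
    (∀ x, MTensor.leftUnitor C (MTensor.map counit.tosInfHom (sInfHom.id C) (comul x)) = x) ↔
      ∀ a, mul e a = a := by
  have key : ∀ q x, IsCompletelyJoinPrime q →
      (q ≤ MTensor.leftUnitor C (MTensor.map counit.tosInfHom (sInfHom.id C) (comul x)) ↔
        mul e q ≤ x) := fun q x hq => by
    rw [hq.isPrimePair, MTensor.leftUnitor_map_le_iff hce he.isPrimePair hq.isPrimePair,
      h.comul_le_tmul_iff he.isPrimePair hq.isPrimePair, not_not]
  constructor
  · intro hx a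
    refine eq_of_forall_ge_iff fun z => ?_
    have h1 : mul e a ≤ z ↔ ∀ q, IsCompletelyJoinPrime q → q ≤ a → mul e q ≤ z := by
      conv_lhs => rw [← (primeSeparated C).sSup_prime_eq a, h.sSup_right_le_iff]
      exact ⟨fun h q h1 h2 => h q ⟨h1, h2⟩, fun h q hq => h q hq.1 hq.2⟩
    rw [h1, forall_prime_le_iff C (x := a)]
    exact forall₃_congr fun q hq _ => by rw [← key q z hq, hx]
  · intro hm x
    refine le_antisymm ?_ ?_ <;> rw [forall_prime_le_iff] <;> intro q hq
    · rw [key q x hq, hm]; exact id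
    · rw [key q x hq, hm]; exact id

theorem counit_right_iff (h : IsProductOf mul comul) (he : IsCompletelyJoinPrime e)
    (hce : ∀ x, counit x ↔ e ≤ x) :
    (∀ x, MTensor.rightUnitor C (MTensor.map (sInfHom.id C) counit.tosInfHom (comul x)) = x) ↔
      ∀ a, mul a e = a := by
  have key : ∀ q x, IsCompletelyJoinPrime q →
      (q ≤ MTensor.rightUnitor C (MTensor.map (sInfHom.id C) counit.tosInfHom (comul x)) ↔
        mul q e ≤ x) := fun q x hq => by
    rw [hq.isPrimePair, MTensor.rightUnitor_map_le_iff hce he.isPrimePair hq.isPrimePair,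
      h.comul_le_tmul_iff hq.isPrimePair he.isPrimePair, not_not]
  constructor
  · intro hx a
    refine eq_of_forall_ge_iff fun z => ?_
    have h1 : mul a e ≤ z ↔ ∀ q, IsCompletelyJoinPrime q → q ≤ a → mul q e ≤ z := by
      conv_lhs => rw [← (primeSeparated C).sSup_prime_eq a, h.sSup_left_le_iff]
      exact ⟨fun h q h1 h2 => h q ⟨h1, h2⟩, fun h q hq => h q hq.1 hq.2⟩
    rw [h1, forall_prime_le_iff C (x := a)]
    exact forall₃_congr fun q hq _ => by rw [← key q z hq, hx]
  · intro hm x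
    refine le_antisymm ?_ ?_ <;> rw [forall_prime_le_iff] <;> intro q hq
    · rw [key q x hq, hm]; exact id
    · rw [key q x hq, hm]; exact id

end

/-- A complete lattice homomorphism commutes with comultiplications if and only if its left adjoint
commutes with products. -/
theorem map_comul_iff {C D : Type*} [CompletelyDistribLattice C] [IsCompactlyGenerated C]
    [CompletelyDistribLattice D] [IsCompactlyGenerated D] {mulC : C → C → C} {mulD : D → D → D}
    {comulC : CompleteLatticeHom C (MTensor C C)} {comulD : CompleteLatticeHom D (MTensor D D)}
    (hC : IsProductOf mulC comulC) (hD : IsProductOf mulD comulD) (f : CompleteLatticeHom C D) :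
    (∀ x, MTensor.map f.tosInfHom f.tosInfHom (comulC x) = comulD (f x)) ↔
      ∀ a b, leftAdj f (mulD a b) = mulC (leftAdj f a) (leftAdj f b) := by
  have key : ∀ p m q n : D, IsPrimePair p m → IsPrimePair q n → ∀ x,
      (MTensor.map f.tosInfHom f.tosInfHom (comulC x) ≤ MTensor.tmul m n ↔
        ¬ mulC (leftAdj f p) (leftAdj f q) ≤ x) := by
    intro p m q n hp hq x
    have hp' := (hp.isCompletelyJoinPrime.leftAdj f).isPrimePair
    have hq' := (hq.isCompletelyJoinPrime.leftAdj f).isPrimePair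
    rw [MTensor.map_le_tmul_iff _ _ hp hq
      (fun j => hp.le_iff.trans ((leftAdj_hom_le_iff f).not.symm.trans hp'.le_iff.symm))
      (fun j => hq.le_iff.trans ((leftAdj_hom_le_iff f).not.symm.trans hq'.le_iff.symm)),
      hC.comul_le_tmul_iff hp' hq']
  constructor
  · intro hx
    have hprime : ∀ p q, IsCompletelyJoinPrime p → IsCompletelyJoinPrime q →
        leftAdj f (mulD p q) = mulC (leftAdj f p) (leftAdj f q) := fun p q hp hq =>
      eq_of_forall_ge_iff fun x => by
        rw [leftAdj_hom_le_iff, ← not_iff_not, ← key _ _ _ _ hp.isPrimePair hq.isPrimePair, hx,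
          hD.comul_le_tmul_iff hp.isPrimePair hq.isPrimePair]
    -- A left adjoint preserves joins, so it is determined by its values on primes; this extends
    -- `hprime` to all elements.
    have hsup : ∀ a, leftAdj f a = sSup (leftAdj f '' {p | IsCompletelyJoinPrime p ∧ p ≤ a}) :=
      fun a => eq_of_forall_ge_iff fun x => by
        rw [leftAdj_hom_le_iff, _root_.sSup_le_iff, Set.forall_mem_image]
        simp only [leftAdj_hom_le_iff]
        rw [← _root_.sSup_le_iff, (primeSeparated D).sSup_prime_eq]
    intro a b
    refine eq_of_forall_ge_iff fun x => ?_
    rw [leftAdj_hom_le_iff, hD.le_iff_forall_prime, hsup a, hsup b, hC.sSup_le_iff]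
    simp only [Set.forall_mem_image]
    constructor
    · intro h p hp q hq
      rw [← hprime p q hp.1 hq.1, leftAdj_hom_le_iff]
      exact h p hp.1 hp.2 q hq.1 hq.2
    · intro h p hp hpa q hq hqb
      rw [← leftAdj_hom_le_iff, hprime p q hp hq]
      exact h ⟨hp, hpa⟩ ⟨hq, hqb⟩
  · intro h x
    refine MTensor.eq_of_le_tmul_iff (primeSeparated D) (primeSeparated D)
      fun p m q n hp hq => ?_
    rw [key p m q n hp hq, hD.comul_le_tmul_iff hp hq, ← h, leftAdj_hom_le_iff]

/-- Lax compatibility of a join-preserving map with comultiplications. -/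
theorem map_joinComul_le_iff {C D : Type*} [CompletelyDistribLattice C] [IsCompactlyGenerated C]
    [CompletelyDistribLattice D] [IsCompactlyGenerated D] {mulC : C → C → C} {mulD : D → D → D}
    {comulC : C → MTensor C C} {comulD : D → MTensor D D}
    (hC : IsProductOf mulC comulC) (hD : IsProductOf mulD comulD) (f : sSupHom C D) :
    (∀ x, JTensor.map f f ((omega C C).symm (comulC x)) ≤ (omega D D).symm (comulD (f x))) ↔
      ∀ a b, mulD (f a) (f b) ≤ f (mulC a b) := by
  -- The element `γ x` is the join of the pure tensors `a ⊗ b` with `a b ≤ x`.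
  have key : ∀ x, JTensor.map f f ((omega C C).symm (comulC x)) ≤ (omega D D).symm (comulD (f x)) ↔
      ∀ a b, mulC a b ≤ x → mulD (f a) (f b) ≤ f x := fun x => by
    rw [JTensor.map, JTensor.lift_apply, iSup₂_le_iff, Prod.forall]
    simp only [← JTensor.tmul_le_iff, hC _ _ x, hD _ _ (f x)]
  simp only [key]
  exact ⟨fun h a b => h _ a b le_rfl,
    fun h x a b hx => (h a b).trans (OrderHomClass.mono f hx)⟩

end IsProductOf

/-! ### The product of a residuation structure -/

namespace ResiduationStr

variable {R : Type u} [CompletelyDistribLattice R] (s : ResiduationStr R)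

/-- The product with residuals `lres` and `rres`. -/
def mul (a b : R) : R := leftAdj (s.lres a) b

theorem mul_le_iff_lres {a b c : R} : s.mul a b ≤ c ↔ b ≤ s.lres a c :=
  leftAdj_le_iff (s.lres_sInf a)

theorem mul_le_iff_rres {a b c : R} : s.mul a b ≤ c ↔ a ≤ s.rres c b :=
  s.mul_le_iff_lres.trans (s.residuation a b c)

theorem mul_mono {a a' b b' : R} (ha : a ≤ a') (hb : b ≤ b') : s.mul a b ≤ s.mul a' b' :=
  s.mul_le_iff_lres.2 (hb.trans (s.mul_le_iff_lres.1
    (s.mul_le_iff_rres.2 (ha.trans (s.mul_le_iff_rres.1 le_rfl)))))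

theorem mul_lres_le (x z : R) : s.mul x (s.lres x z) ≤ z := s.mul_le_iff_lres.2 le_rfl

theorem rres_mul_le (z y : R) : s.mul (s.rres z y) y ≤ z := s.mul_le_iff_rres.2 le_rfl

theorem ext_of_mul {s t : ResiduationStr R} (h : s.mul = t.mul) : s = t := by
  ext x z
  · exact eq_of_forall_le_iff fun b => by rw [← mul_le_iff_lres, h, mul_le_iff_lres]
  · exact eq_of_forall_le_iff fun b => by rw [← mul_le_iff_rres, h, mul_le_iff_rres]

/-- The element of `R ⊗ R` representing the pairs with product below `z`. -/
def joinComul (z : R) : JTensor R R where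
  carrier := {x | s.mul x.1 x.2 ≤ z}
  lower := fun _ _ h hx => (s.mul_mono h.1 h.2).trans hx
  sSup_mem := fun _ _ h => s.mul_le_iff_lres.2 (sSup_le fun b hb => s.mul_le_iff_lres.1
    (s.mul_le_iff_rres.2 (sSup_le fun a ha => s.mul_le_iff_rres.1 (h a ha b hb))))

theorem tmul_le_joinComul_iff {a b z : R} : JTensor.tmul a b ≤ s.joinComul z ↔ s.mul a b ≤ z :=
  JTensor.tmul_le_iff

end ResiduationStr

/-! ### From derivation structures to comonoid structures. -/

namespace DerivationStr

variable {R : Type u} [CompletelyDistribLattice R] (d : DerivationStr R)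

theorem unit_mul (a : R) : d.mul d.unit a = a :=
  eq_of_forall_ge_iff fun c => by rw [d.mul_le_iff_lres, d.unit_lres]

theorem mul_unit (a : R) : d.mul a d.unit = a :=
  eq_of_forall_ge_iff fun c => by rw [d.mul_le_iff_rres, d.rres_unit]

/-- Transposing both bracketings across the residuals turns associativity into `a \ (z / c) = (a \
z) / c`. -/
theorem mul_assoc (a b c : R) : d.mul (d.mul a b) c = d.mul a (d.mul b c) :=
  eq_of_forall_ge_iff fun z => by
    rw [d.mul_le_iff_rres, d.mul_le_iff_lres, d.assoc, ← d.mul_le_iff_rres, ← d.mul_le_iff_lres]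

/-- `p q ≤ ⋁ A` means `q ≤ p \ ⋁ A`, and purity distributes the residual by `p` over the join. -/
theorem mul_prime {p q : R} (hp : IsCompletelyJoinPrime p) (hq : IsCompletelyJoinPrime q) :
    IsCompletelyJoinPrime (d.mul p q) := by
  intro A hA
  rw [d.mul_le_iff_lres, d.pure_lres p A hp, ← sSup_image] at hA
  obtain ⟨_, ⟨a, ha, rfl⟩, h⟩ := hq _ hA
  exact ⟨a, ha, d.mul_le_iff_lres.2 h⟩

theorem ext_of_mul {s t : DerivationStr R} (h : s.mul = t.mul) (h' : s.unit = t.unit) : s = t := by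
  have := ResiduationStr.ext_of_mul h
  rw [ResiduationStr.ext_iff] at this
  exact DerivationStr.ext this.1 this.2 h'

/-- Join preservation need only be tested on `p ⊗ q` with `p`, `q` prime, where it is primality of
`p q`. -/
theorem joinComul_sSup [IsCompactlyGenerated R] (A : Set R) :
    d.joinComul (sSup A) = ⨆ a ∈ A, d.joinComul a := by
  apply le_antisymm
  · by_contra hc
    obtain ⟨p, m, q, n, hp, hq, h1, h2⟩ :=
      JTensor.exists_primePair (primeSeparated R) (primeSeparated R) hc
    rw [d.tmul_le_joinComul_iff] at h1
    obtain ⟨a, ha, h⟩ := d.mul_prime hp.isCompletelyJoinPrime hq.isCompletelyJoinPrime A h1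
    exact h2 (le_iSup₂_of_le a ha (d.tmul_le_joinComul_iff.2 h))
  · exact iSup₂_le fun a ha _ hx => le_trans hx (le_sSup ha)

theorem joinComul_sInf (A : Set R) : d.joinComul (sInf A) = ⨅ a ∈ A, d.joinComul a := by
  apply le_antisymm
  · exact le_iInf₂ fun a ha _ hx => le_trans hx (sInf_le ha)
  · rw [JTensor.le_iff]
    intro x y hxy
    rw [d.tmul_le_joinComul_iff]
    exact le_sInf fun a ha => d.tmul_le_joinComul_iff.1 ((le_iInf₂_iff.1 hxy) a ha)

/-- The counit of a derivation structure. -/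
def counit : CompleteLatticeHom R Prop where
  toFun z := d.unit ≤ z
  map_sInf' A := by
    refine propext ⟨?_, fun h => le_sInf fun a ha => h _ ⟨a, ha, rfl⟩⟩
    rintro h _ ⟨a, ha, rfl⟩
    exact le_trans h (sInf_le ha)
  map_sSup' A := by
    refine propext ⟨fun h => ?_, fun ⟨_, ⟨a, ha, rfl⟩, h⟩ => le_trans h (le_sSup ha)⟩
    obtain ⟨a, ha, h⟩ := d.unit_prime A h
    exact ⟨_, ⟨a, ha, rfl⟩, h⟩

theorem counit_iff (z : R) : d.counit z ↔ d.unit ≤ z := Iff.rfl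

variable [IsCompactlyGenerated R]

/-- The comultiplication of a derivation structure. -/
def comul : CompleteLatticeHom R (MTensor R R) where
  toFun z := omega R R (d.joinComul z)
  map_sInf' A := by
    simp only [d.joinComul_sInf, OrderIso.map_iInf, sInf_image]
  map_sSup' A := by
    simp only [d.joinComul_sSup, OrderIso.map_iSup, sSup_image]

theorem isProductOf_mul : IsProductOf d.mul d.comul := fun a b z => by
  rw [← d.tmul_le_joinComul_iff]
  change _ ≤ (omega R R).symm (omega R R (d.joinComul z)) ↔ _
  rw [OrderIso.symm_apply_apply]

/-- The comonoid structure of a derivation structure. -/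
def toComonoidStr : ComonoidStr R where
  comul := d.comul
  counit := d.counit
  coassoc := d.isProductOf_mul.coassoc_iff.2 d.mul_assoc
  counit_left := (d.isProductOf_mul.counit_left_iff d.unit_prime d.counit_iff).2 d.unit_mul
  counit_right := (d.isProductOf_mul.counit_right_iff d.unit_prime d.counit_iff).2 d.mul_unit

end DerivationStr

/-! ### From comonoid structures to derivation structures. -/

namespace ComonoidStr

variable {C : Type u} [CompletelyDistribLattice C] (s : ComonoidStr C)

/-- The unit of the product of a comonoid structure. -/
def unit : C := leftAdj s.counit True

theorem counit_iff (x : C) : s.counit x ↔ s.unit ≤ x := by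
  rw [unit, leftAdj_hom_le_iff]
  exact ⟨fun h _ => h, fun h => h trivial⟩

theorem unit_prime : IsCompletelyJoinPrime s.unit := by
  -- It remains to see that `True` is completely join-prime in `Prop`.
  apply IsCompletelyJoinPrime.leftAdj
  intro A hA
  obtain ⟨a, ha, h⟩ := hA trivial
  exact ⟨a, ha, fun _ => h⟩

variable [IsCompactlyGenerated C]

/-- The product of a comonoid structure. -/
def mul : C → C → C := productOf s.comul

theorem isProductOf_mul : IsProductOf s.mul s.comul := isProductOf_productOf _

theorem unit_mul (a : C) : s.mul s.unit a = a :=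
  (s.isProductOf_mul.counit_left_iff s.unit_prime s.counit_iff).1 s.counit_left a

theorem mul_unit (a : C) : s.mul a s.unit = a :=
  (s.isProductOf_mul.counit_right_iff s.unit_prime s.counit_iff).1 s.counit_right a

theorem mul_assoc (a b c : C) : s.mul (s.mul a b) c = s.mul a (s.mul b c) :=
  s.isProductOf_mul.coassoc_iff.1 s.coassoc a b c

/-- The left residual of a comonoid structure. -/
def lres (x z : C) : C := sSup {b | s.mul x b ≤ z}

/-- The right residual of a comonoid structure. -/
def rres (z y : C) : C := sSup {a | s.mul a y ≤ z}

theorem le_lres_iff {a b z : C} : b ≤ s.lres a z ↔ s.mul a b ≤ z := by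
  refine ⟨fun h => (s.isProductOf_mul.mono le_rfl h).trans ?_, fun h => le_sSup h⟩
  exact (s.isProductOf_mul.sSup_right_le_iff _ _ _).2 fun _ h => h

theorem le_rres_iff {a b z : C} : a ≤ s.rres z b ↔ s.mul a b ≤ z := by
  refine ⟨fun h => (s.isProductOf_mul.mono h le_rfl).trans ?_, fun h => le_sSup h⟩
  exact (s.isProductOf_mul.sSup_left_le_iff _ _ _).2 fun _ h => h

/-- The derivation structure of a comonoid structure. -/
def toDerivationStr : DerivationStr C where
  lres := s.lres
  rres := s.rres
  lres_sSup A z := eq_of_forall_le_iff fun b => by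
    simp only [le_lres_iff, le_iInf_iff, s.isProductOf_mul.sSup_left_le_iff]
  lres_sInf x A := eq_of_forall_le_iff fun b => by
    simp only [le_lres_iff, le_iInf_iff, le_sInf_iff]
  rres_sInf A y := eq_of_forall_le_iff fun b => by
    simp only [le_rres_iff, le_iInf_iff, le_sInf_iff]
  rres_sSup z A := eq_of_forall_le_iff fun b => by
    simp only [le_rres_iff, le_iInf_iff, s.isProductOf_mul.sSup_right_le_iff]
  residuation a b c := s.le_lres_iff.trans s.le_rres_iff.symm
  unit := s.unit
  unit_prime := s.unit_prime
  unit_lres z := eq_of_forall_le_iff fun b => by rw [le_lres_iff, unit_mul]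
  rres_unit z := eq_of_forall_le_iff fun b => by rw [le_rres_iff, mul_unit]
  assoc x y z := eq_of_forall_le_iff fun b => by
    rw [le_lres_iff, le_rres_iff, le_rres_iff, le_lres_iff, mul_assoc]
  pure_lres p A hp := by
    refine le_antisymm ?_ (iSup₂_le fun a ha => s.le_lres_iff.2
      ((s.le_lres_iff.1 le_rfl).trans (le_sSup ha)))
    -- For a prime `q` below the residual, `p q` is prime and below `⋁ A`, hence below a single `a`.
    rw [forall_prime_le_iff]
    intro q hq hqp
    obtain ⟨a, ha, h⟩ := s.isProductOf_mul.prime hp hq A (s.le_lres_iff.1 hqp)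
    exact le_iSup₂_of_le a ha (s.le_lres_iff.2 h)
  pure_rres p A hp := by
    refine le_antisymm ?_ (iSup₂_le fun a ha => s.le_rres_iff.2
      ((s.le_rres_iff.1 le_rfl).trans (le_sSup ha)))
    rw [forall_prime_le_iff]
    intro q hq hqp
    obtain ⟨a, ha, h⟩ := s.isProductOf_mul.prime hq hp A (s.le_rres_iff.1 hqp)
    exact le_iSup₂_of_le a ha (s.le_rres_iff.2 h)

theorem toDerivationStr_mul : s.toDerivationStr.mul = s.mul :=
  funext₂ fun _ _ => eq_of_forall_ge_iff fun _ =>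
    (s.toDerivationStr.mul_le_iff_lres).trans s.le_lres_iff

theorem toComonoidStr_toDerivationStr : s.toDerivationStr.toComonoidStr = s := by
  apply ComonoidStr.ext
  · have := s.toDerivationStr.isProductOf_mul
    rw [toDerivationStr_mul] at this
    exact this.comul_unique s.isProductOf_mul
  · exact DFunLike.ext _ _ fun x => propext (s.counit_iff x).symm

end ComonoidStr

theorem DerivationStr.toDerivationStr_toComonoidStr {R : Type u} [CompletelyDistribLattice R]
    [IsCompactlyGenerated R] (d : DerivationStr R) : d.toComonoidStr.toDerivationStr = d := by
  apply DerivationStr.ext_of_mul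
  · rw [ComonoidStr.toDerivationStr_mul]
    exact d.toComonoidStr.isProductOf_mul.unique d.isProductOf_mul
  · exact eq_of_forall_ge_iff fun x => (d.toComonoidStr.counit_iff x).symm

/-! ### Morphisms -/

/-- Residuation morphisms are the complete lattice homomorphisms whose left adjoint preserves
products. -/
theorem residuation_conditions_iff {R S : Type u} [CompletelyDistribLattice R]
    [CompletelyDistribLattice S] (r : ResiduationStr R) (s : ResiduationStr S)
    (f : CompleteLatticeHom R S) :
    ((∀ x z, f (r.lres x z) ≤ s.lres (f x) (f z)) ∧
      (∀ x z, f (r.rres z x) ≤ s.rres (f z) (f x)) ∧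
      (∀ y z, ∃ x, y ≤ f x ∧ s.lres y (f z) = f (r.lres x z)) ∧
      (∀ y z, ∃ x, y ≤ f x ∧ s.rres (f z) y = f (r.rres z x))) ↔
    ∀ a b, leftAdj f (s.mul a b) = r.mul (leftAdj f a) (leftAdj f b) := by
  have unit_le : ∀ a, a ≤ f (leftAdj f a) := fun a => (leftAdj_hom_le_iff f).1 le_rfl
  have counit_le : ∀ x, leftAdj f (f x) ≤ x := fun a => (leftAdj_hom_le_iff f).2 le_rfl
  constructor
  · rintro ⟨h1, -, h3, -⟩ a b
    refine eq_of_forall_ge_iff fun z => ?_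
    rw [leftAdj_hom_le_iff, s.mul_le_iff_lres]
    constructor
    · intro h
      -- The back condition replaces the residual by one in the image of `f`, which can be
      -- transposed along the adjunction.
      obtain ⟨x, hx, hx'⟩ := h3 a z
      rw [hx', ← leftAdj_hom_le_iff, ← r.mul_le_iff_lres] at h
      exact (r.mul_mono ((leftAdj_hom_le_iff f).2 hx) le_rfl).trans h
    · rw [r.mul_le_iff_lres, leftAdj_hom_le_iff]
      intro h
      rw [← s.mul_le_iff_lres]
      exact (s.mul_mono (unit_le a) le_rfl).trans (s.mul_le_iff_lres.2 (h.trans (h1 _ _)))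
  · intro h
    -- The witness for the back conditions is the least `x` with `y ≤ f x`.
    refine ⟨fun x z => ?_, fun x z => ?_, fun y z => ⟨leftAdj f y, unit_le y, ?_⟩,
      fun y z => ⟨leftAdj f y, unit_le y, ?_⟩⟩
    · rw [← s.mul_le_iff_lres, ← leftAdj_hom_le_iff, h]
      exact (r.mul_mono (counit_le _) (counit_le _)).trans (r.mul_lres_le x z)
    · rw [← s.mul_le_iff_rres, ← leftAdj_hom_le_iff, h]
      exact (r.mul_mono (counit_le _) (counit_le _)).trans (r.rres_mul_le z x)
    · refine eq_of_forall_le_iff fun b => ?_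
      rw [← s.mul_le_iff_lres, ← leftAdj_hom_le_iff, h, r.mul_le_iff_lres, leftAdj_hom_le_iff]
    · refine eq_of_forall_le_iff fun b => ?_
      rw [← s.mul_le_iff_rres, ← leftAdj_hom_le_iff, h, r.mul_le_iff_rres, leftAdj_hom_le_iff]

/-- The lax product law is symmetric in left and right, which is why corelational morphisms need a
condition on one residual only. -/
theorem lres_le_iff {R S : Type u} [CompletelyDistribLattice R]
    [CompletelyDistribLattice S] (r : ResiduationStr R) (s : ResiduationStr S)
    (f : sSupHom R S) :
    (∀ x z, f (r.lres x z) ≤ s.lres (f x) (f z)) ↔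
      ∀ a b, s.mul (f a) (f b) ≤ f (r.mul a b) := by
  constructor
  · intro h a b
    rw [s.mul_le_iff_lres]
    exact (OrderHomClass.mono f (r.mul_le_iff_lres.1 le_rfl)).trans (h a _)
  · intro h x z
    rw [← s.mul_le_iff_lres]
    exact (h _ _).trans (OrderHomClass.mono f (r.mul_lres_le x z))

/-! ### Isomorphisms of categories from functors -/

section Cat

variable {A : Type w} [Category.{u} A] {B D : Type v} [Category.{u} B] [Category.{u} D]

/-- A fully faithful functor that is bijective on objects is an isomorphism of categories. -/
theorem exists_iso_of_fullyFaithful (F : B ⥤ D) [F.Full] [F.Faithful] (g : D → B)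
    (hFg : ∀ d, F.obj (g d) = d) (hgF : ∀ b, g (F.obj b) = b) :
    ∃ I : Cat.of B ≅ Cat.of D, I.hom.toFunctor = F := by
  let G : D ⥤ B :=
    { obj := g
      map := fun {X Y} f => F.preimage (eqToHom (hFg X) ≫ f ≫ eqToHom (hFg Y).symm)
      map_id := fun X => F.map_injective (by simp)
      map_comp := fun f f' => F.map_injective (by simp) }
  have h1 : F ⋙ G = 𝟭 B := CategoryTheory.Functor.ext hgF fun X Y f =>
    F.map_injective (by simp [G, eqToHom_map])
  have h2 : G ⋙ F = 𝟭 D := CategoryTheory.Functor.ext hFg fun X Y f => by simp [G]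
  exact ⟨⟨F.toCatHom, G.toCatHom, congrArg Functor.toCatHom h1, congrArg Functor.toCatHom h2⟩, rfl⟩

theorem restrictsIso_of_iff (F : B ⥤ D) [F.Full] [F.Faithful] (g : D → B)
    (hFg : ∀ d, F.obj (g d) = d) (hgF : ∀ b, g (F.obj b) = b) (I : Cat.of B ≅ Cat.of D)
    (hI : I.hom.toFunctor = F) (P : ObjectProperty B) (Q : ObjectProperty D)
    (h : ∀ b, P b ↔ Q (F.obj b)) : RestrictsIso I P Q := by
  obtain ⟨I', hI'⟩ := exists_iso_of_fullyFaithful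
    (Q.lift (P.ι ⋙ F) fun X => (h X.obj).1 X.property)
    (fun d => ⟨g d.obj, (h _).2 (by rw [hFg]; exact d.property)⟩)
    (fun d => ObjectProperty.FullSubcategory.ext (hFg d.obj))
    (fun b => ObjectProperty.FullSubcategory.ext (hgF b.obj))
  refine ⟨I', ?_⟩
  rw [hI', hI]
  rfl

/-- The restriction stays full and faithful. Essential surjectivity holds because `Q` is closed
under isomorphism and preimages of `Q`-objects satisfy `P`. -/
theorem restrictsDualEquiv_of_iff (E : Aᵒᵖ ≌ B) (P : ObjectProperty A) (Q : ObjectProperty B)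
    [Q.IsClosedUnderIsomorphisms] (h : ∀ a, P a.unop ↔ Q (E.functor.obj a)) :
    RestrictsDualEquiv E P Q := by
  let F : P.FullSubcategoryᵒᵖ ⥤ Q.FullSubcategory :=
    Q.lift (P.ι.op ⋙ E.functor) fun X => (h _).1 X.unop.property
  have : F.EssSurj := ⟨fun Y => by
    have i := E.functor.objObjPreimageIso Y.obj
    have hP : P (E.functor.objPreimage Y.obj).unop := (h _).2 (Q.prop_of_iso i.symm Y.property)
    exact ⟨Opposite.op ⟨_, hP⟩, ⟨Q.isoMk i⟩⟩⟩
  have : F.IsEquivalence := { }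
  exact ⟨F.asEquivalence, ⟨Iso.refl _⟩⟩

/-- The duality is built with values in `D` and carried back to `B` along the inverse of `F`. -/
theorem exists_dualEquiv_and_iso (G : Aᵒᵖ ⥤ D) [G.IsEquivalence] (F : B ⥤ D) [F.Full] [F.Faithful]
    (g : D → B) (hFg : ∀ d, F.obj (g d) = d) (hgF : ∀ b, g (F.obj b) = b)
    (P : ObjectProperty A) (Q : ObjectProperty B) (S : ObjectProperty D)
    [S.IsClosedUnderIsomorphisms] (hP : ∀ a, P a.unop ↔ S (G.obj a))
    (hQ : ∀ b, Q b ↔ S (F.obj b)) :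
    ∃ (E : Aᵒᵖ ≌ B) (I : Cat.of B ≅ Cat.of D), RestrictsDualEquiv E P Q ∧ RestrictsIso I Q S := by
  obtain ⟨I, hI⟩ := exists_iso_of_fullyFaithful F g hFg hgF
  have : F.EssSurj := ⟨fun d => ⟨g d, ⟨eqToIso (hFg d)⟩⟩⟩
  have : F.IsEquivalence := { }
  have : Q.IsClosedUnderIsomorphisms :=
    ⟨fun i hX => (hQ _).2 (S.prop_of_iso (F.mapIso i) ((hQ _).1 hX))⟩
  refine ⟨G.asEquivalence.trans F.asEquivalence.symm, I, ?_,
    restrictsIso_of_iff F g hFg hgF I hI Q S hQ⟩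
  refine restrictsDualEquiv_of_iff _ _ _ fun a => ?_
  rw [hP, hQ]
  exact S.prop_iff_of_iso (F.asEquivalence.counitIso.app (G.obj a)).symm

end Cat

/-! ### Comonoids and derivation lattices -/

/-- Both sides say that the left adjoint of `f` preserves products. -/
theorem pure_iff_residuation (C D : Comon.{u}) (f : CompleteLatticeHom C.toACDL D.toACDL) :
    (∀ x, MTensor.map f.tosInfHom f.tosInfHom (C.str.comul x) = D.str.comul (f x)) ↔
    ((∀ x z, f (C.str.lres x z) ≤ D.str.lres (f x) (f z)) ∧
      (∀ x z, f (C.str.rres z x) ≤ D.str.rres (f z) (f x)) ∧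
      (∀ y z, ∃ x, y ≤ f x ∧ D.str.lres y (f z) = f (C.str.lres x z)) ∧
      (∀ y z, ∃ x, y ≤ f x ∧ D.str.rres (f z) y = f (C.str.rres z x))) := by
  refine (C.str.isProductOf_mul.map_comul_iff D.str.isProductOf_mul f).trans ?_
  rw [← C.str.toDerivationStr_mul, ← D.str.toDerivationStr_mul]
  exact (residuation_conditions_iff C.str.toDerivationStr.toResiduationStr
    D.str.toDerivationStr.toResiduationStr f).symm

/-- The functor from comonoids to derivation lattices. -/
def comonToDerACDL : Comon.{u} ⥤ DerACDL.{u} where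
  obj C := ⟨C.toACDL, C.str.toDerivationStr⟩
  map {C D} f :=
    { hom := f.hom
      forth_lres := ((pure_iff_residuation C D f.hom).1 f.map_comul).1
      forth_rres := ((pure_iff_residuation C D f.hom).1 f.map_comul).2.1
      back_lres := ((pure_iff_residuation C D f.hom).1 f.map_comul).2.2.1
      back_rres := ((pure_iff_residuation C D f.hom).1 f.map_comul).2.2.2
      unit_le_iff := fun x => by
        change C.str.unit ≤ x ↔ D.str.unit ≤ f.hom x
        rw [← C.str.counit_iff, ← D.str.counit_iff, f.map_counit] }

instance : comonToDerACDL.Faithful where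
  map_injective h := Comon.Hom.ext (congrArg DerACDL.Hom.hom h)

instance : comonToDerACDL.Full where
  map_surjective {C D} f :=
    ⟨{ hom := f.hom
       map_comul := (pure_iff_residuation C D f.hom).2
        ⟨f.forth_lres, f.forth_rres, f.back_lres, f.back_rres⟩
       map_counit := fun x => propext
        ((C.str.counit_iff x).trans ((f.unit_le_iff x).trans (D.str.counit_iff _).symm)) }, rfl⟩

/-- The comonoid of a derivation lattice. -/
def DerACDL.toComon (R : DerACDL.{u}) : Comon.{u} := ⟨R.toACDL, R.str.toComonoidStr⟩

theorem comonToDerACDL_obj_toComon (R : DerACDL.{u}) : comonToDerACDL.obj R.toComon = R :=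
  congrArg (DerACDL.mk R.toACDL) R.str.toDerivationStr_toComonoidStr

theorem toComon_comonToDerACDL_obj (C : Comon.{u}) : (comonToDerACDL.obj C).toComon = C :=
  congrArg (Comon.mk C.toACDL) C.str.toComonoidStr_toDerivationStr

theorem map_comul_le_iff (C D : Comon.{u}) (f : sSupHom C.toACDL D.toACDL) :
    (∀ x, JTensor.map f f (C.str.joinComul x) ≤ D.str.joinComul (f x)) ↔
      ∀ x z, f (C.str.lres x z) ≤ D.str.lres (f x) (f z) := by
  refine (IsProductOf.map_joinComul_le_iff C.str.isProductOf_mul D.str.isProductOf_mul f).trans ?_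
  rw [← C.str.toDerivationStr_mul, ← D.str.toDerivationStr_mul]
  exact (lres_le_iff C.str.toDerivationStr.toResiduationStr
    D.str.toDerivationStr.toResiduationStr f).symm

theorem map_counit_le_iff (C D : Comon.{u}) (f : sSupHom C.toACDL D.toACDL) :
    (∀ x, C.str.counit x ≤ D.str.counit (f x)) ↔ D.str.unit ≤ f C.str.unit := by
  have : ∀ x, C.str.counit x ≤ D.str.counit (f x) ↔ (C.str.unit ≤ x → D.str.unit ≤ f x) :=
    fun x => imp_congr (C.str.counit_iff x) (D.str.counit_iff _)
  simp only [this]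
  exact ⟨fun h => h _ le_rfl, fun h x hx => h.trans (OrderHomClass.mono f hx)⟩

/-- The functor from comonoids to derivation lattices, for corelational morphisms. -/
def relComonToRelDerACDL : RelComon.{u} ⥤ RelDerACDL.{u} where
  obj C := ⟨comonToDerACDL.obj C.toComon⟩
  map {C D} f :=
    { hom := f.hom
      map_top := f.map_top
      lres_le := (map_comul_le_iff C.toComon D.toComon f.hom).1 f.map_comul_le
      unit_le := (map_counit_le_iff C.toComon D.toComon f.hom).1 f.map_counit_le }

instance : relComonToRelDerACDL.Faithful where
  map_injective h := RelComon.Hom.ext (congrArg RelDerACDL.Hom.hom h)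

instance : relComonToRelDerACDL.Full where
  map_surjective {C D} f :=
    ⟨{ hom := f.hom
       map_top := f.map_top
       map_comul_le := (map_comul_le_iff C.toComon D.toComon f.hom).2 f.lres_le
       map_counit_le := (map_counit_le_iff C.toComon D.toComon f.hom).2 f.unit_le }, rfl⟩

/-! ### Lattices of downsets -/

section LowerSet

theorem lowerSet_eq_sSup_Iic {α : Type*} [PartialOrder α] (A : LowerSet α) :
    A = sSup (LowerSet.Iic '' (A : Set α)) := by
  refine SetLike.ext fun a => ?_
  rw [LowerSet.mem_sSup_iff, Set.exists_mem_image]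
  exact ⟨fun h => ⟨a, h, le_refl a⟩, fun ⟨_, hb, h⟩ => A.lower h hb⟩

theorem isCompletelyJoinPrime_Iic {α : Type*} [PartialOrder α] (a : α) :
    IsCompletelyJoinPrime (LowerSet.Iic a) := by
  intro A hA
  obtain ⟨S, hS, h⟩ := LowerSet.mem_sSup_iff.1 (LowerSet.Iic_le.1 hA)
  exact ⟨S, hS, LowerSet.Iic_le.2 h⟩

/-- A downset is the union of its principal downsets, so a prime one is contained in one of them. -/
theorem exists_eq_Iic {α : Type*} [PartialOrder α] {A : LowerSet α}
    (hA : IsCompletelyJoinPrime A) : ∃ a, A = LowerSet.Iic a := by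
  obtain ⟨_, ⟨a, ha, rfl⟩, h⟩ := hA _ (lowerSet_eq_sSup_Iic A).le
  exact ⟨a, le_antisymm h (LowerSet.Iic_le.2 ha)⟩

instance {α : Type*} [PartialOrder α] : IsCompactlyGenerated (LowerSet α) where
  exists_sSup_eq A := by
    refine ⟨_, ?_, (lowerSet_eq_sSup_Iic A).symm⟩
    rintro _ ⟨a, -, rfl⟩
    rw [CompleteLattice.isCompactElement_iff_le_of_directed_sSup_le]
    exact fun S _ _ h => isCompletelyJoinPrime_Iic a S h

theorem finite_lowerSet_iff (α : Type*) [PartialOrder α] : Finite (LowerSet α) ↔ Finite α :=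
  ⟨fun _ => Finite.of_injective LowerSet.Iic LowerSet.Iic_injective,
    fun _ => Finite.of_injective (fun A : LowerSet α => (A : Set α)) SetLike.coe_injective⟩

/-- The preimage of downsets under a monotone map. -/
def lowerSetPreimage {α β : Type*} [PartialOrder α] [PartialOrder β] (g : α →o β) :
    CompleteLatticeHom (LowerSet β) (LowerSet α) where
  toFun A := ⟨g ⁻¹' A, fun _ _ h ha => A.lower (g.monotone h) ha⟩
  map_sInf' A := by
    refine SetLike.ext fun a => ?_
    rw [LowerSet.mem_sInf_iff, Set.forall_mem_image]
    exact LowerSet.mem_sInf_iff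
  map_sSup' A := by
    refine SetLike.ext fun a => ?_
    rw [LowerSet.mem_sSup_iff, Set.exists_mem_image]
    exact LowerSet.mem_sSup_iff

end LowerSet

/-! ### Downset lattices of ordered monoids and the downset functor. -/

namespace OrdMon

/-- The residuals of the product of downsets of an ordered monoid. -/
def derivationStr (M : OrdMon.{u}) : DerivationStr (LowerSet M) where
  lres A C := ⟨{b | ∀ a ∈ A, a * b ∈ C}, fun _ _ h hb a ha => C.lower (mul_le_mul_right h a) (hb a ha)⟩
  rres C B := ⟨{a | ∀ b ∈ B, a * b ∈ C}, fun _ _ h ha b hb => C.lower (mul_le_mul_left h b) (ha b hb)⟩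
  lres_sSup A z := by
    refine SetLike.ext fun b => ?_
    simp only [LowerSet.mem_iInf₂_iff]
    change (∀ a ∈ sSup A, _) ↔ _
    simp only [LowerSet.mem_sSup_iff]
    exact ⟨fun h S hS a ha => h a ⟨S, hS, ha⟩, fun h a ⟨S, hS, ha⟩ => h S hS a ha⟩
  lres_sInf x A := by
    refine SetLike.ext fun b => ?_
    simp only [LowerSet.mem_iInf₂_iff]
    change (∀ a ∈ x, a * b ∈ sInf A) ↔ _
    simp only [LowerSet.mem_sInf_iff]
    exact ⟨fun h S hS a ha => h a ha S hS, fun h a ha S hS => h S hS a ha⟩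
  rres_sInf A x := by
    refine SetLike.ext fun b => ?_
    simp only [LowerSet.mem_iInf₂_iff]
    change (∀ a ∈ x, b * a ∈ sInf A) ↔ _
    simp only [LowerSet.mem_sInf_iff]
    exact ⟨fun h S hS a ha => h a ha S hS, fun h a ha S hS => h S hS a ha⟩
  rres_sSup z A := by
    refine SetLike.ext fun b => ?_
    simp only [LowerSet.mem_iInf₂_iff]
    change (∀ a ∈ sSup A, _) ↔ _
    simp only [LowerSet.mem_sSup_iff]
    exact ⟨fun h S hS a ha => h a ⟨S, hS, ha⟩, fun h a ⟨S, hS, ha⟩ => h S hS a ha⟩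
  residuation A B C := ⟨fun h a ha b hb => h hb a ha, fun h b hb a ha => h ha b hb⟩
  unit := LowerSet.Iic 1
  unit_prime := isCompletelyJoinPrime_Iic 1
  unit_lres C := by
    refine SetLike.ext fun b => ?_
    change (∀ a ≤ 1, a * b ∈ C) ↔ _
    exact ⟨fun h => by simpa using h 1 le_rfl, fun h a ha => C.lower (mul_le_of_le_one_left' ha) h⟩
  rres_unit C := by
    refine SetLike.ext fun b => ?_
    change (∀ a ≤ 1, b * a ∈ C) ↔ _
    exact ⟨fun h => by simpa using h 1 le_rfl, fun h a ha => C.lower (mul_le_of_le_one_right' ha) h⟩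
  assoc x y z := by
    refine SetLike.ext fun b => ?_
    change (∀ a ∈ x, ∀ c ∈ y, a * b * c ∈ z) ↔ ∀ c ∈ y, ∀ a ∈ x, a * (b * c) ∈ z
    simp only [mul_assoc]
    exact ⟨fun h c hc a ha => h a ha c hc, fun h a ha c hc => h c hc a ha⟩
  pure_lres p A hp := by
    obtain ⟨a, rfl⟩ := exists_eq_Iic hp
    refine SetLike.ext fun b => ?_
    simp only [LowerSet.mem_iSup₂_iff]
    change (∀ c ≤ a, c * b ∈ sSup A) ↔ ∃ S, ∃ _ : S ∈ A, ∀ c ≤ a, c * b ∈ S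
    simp only [LowerSet.mem_sSup_iff]
    constructor
    · intro h
      -- The greatest element `a` of the prime downset selects one `S`, which then works for every
      -- `c ≤ a`.
      obtain ⟨S, hS, h⟩ := h a le_rfl
      exact ⟨S, hS, fun c hc => S.lower (mul_le_mul_left hc b) h⟩
    · exact fun ⟨S, hS, h⟩ c hc => ⟨S, hS, h c hc⟩
  pure_rres p A hp := by
    obtain ⟨a, rfl⟩ := exists_eq_Iic hp
    refine SetLike.ext fun b => ?_
    simp only [LowerSet.mem_iSup₂_iff]
    change (∀ c ≤ a, b * c ∈ sSup A) ↔ ∃ S, ∃ _ : S ∈ A, ∀ c ≤ a, b * c ∈ S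
    simp only [LowerSet.mem_sSup_iff]
    constructor
    · intro h
      obtain ⟨S, hS, h⟩ := h a le_rfl
      exact ⟨S, hS, fun c hc => S.lower (mul_le_mul_right hc b) h⟩
    · exact fun ⟨S, hS, h⟩ c hc => ⟨S, hS, h c hc⟩

theorem mul_le_iff {M : OrdMon.{u}} {A B C : LowerSet M} :
    M.derivationStr.mul A B ≤ C ↔ ∀ a ∈ A, ∀ b ∈ B, a * b ∈ C := by
  rw [M.derivationStr.mul_le_iff_lres]
  exact ⟨fun h a ha b hb => h hb a ha, fun h b hb a ha => h a ha b hb⟩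

theorem mul_Iic {M : OrdMon.{u}} (a b : M) :
    M.derivationStr.mul (LowerSet.Iic a) (LowerSet.Iic b) = LowerSet.Iic (a * b) := by
  refine eq_of_forall_ge_iff fun C => ?_
  rw [mul_le_iff, LowerSet.Iic_le]
  exact ⟨fun h => h a le_rfl b le_rfl, fun h x hx y hy => C.lower (mul_le_mul' hx hy) h⟩

/-- The derivation lattice of downsets of an ordered monoid. -/
def toDerACDL (M : OrdMon.{u}) : DerACDL.{u} := ⟨⟨LowerSet M⟩, M.derivationStr⟩

/-- Taking preimages of downsets is a residuation morphism. -/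
def preimageHom {M N : OrdMon.{u}} (g : M →*o N) : DerACDL.Hom N.toDerACDL M.toDerACDL where
  hom := lowerSetPreimage (g : M →o N)
  forth_lres (x z : LowerSet N) b hb a ha := by
    change g (a * b) ∈ z
    rw [map_mul]
    exact hb (g a) ha
  forth_rres (x z : LowerSet N) a ha b hb := by
    change g (a * b) ∈ z
    rw [map_mul]
    exact ha (g b) hb
  back_lres (y : LowerSet M) (z : LowerSet N) := by
    -- The witness is the downset generated by `g(y)`, the value at `y` of the left adjoint of the
    -- preimage map.
    refine ⟨(⟨{n | ∃ a ∈ y, n ≤ g a}, fun _ _ h ⟨a, ha, h'⟩ => ⟨a, ha, h.trans h'⟩⟩ : LowerSet N),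
      fun a ha => ⟨a, ha, le_rfl⟩, ?_⟩
    refine SetLike.ext (A := LowerSet M) fun b => ?_
    change (∀ a ∈ y, g (a * b) ∈ z) ↔ ∀ n, (∃ a ∈ y, n ≤ g a) → n * g b ∈ z
    simp only [map_mul]
    exact ⟨fun h n ⟨a, ha, hn⟩ => z.lower (mul_le_mul_left hn _) (h a ha),
      fun h a ha => h _ ⟨a, ha, le_rfl⟩⟩
  back_rres (y : LowerSet M) (z : LowerSet N) := by
    refine ⟨(⟨{n | ∃ a ∈ y, n ≤ g a}, fun _ _ h ⟨a, ha, h'⟩ => ⟨a, ha, h.trans h'⟩⟩ : LowerSet N),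
      fun a ha => ⟨a, ha, le_rfl⟩, ?_⟩
    refine SetLike.ext (A := LowerSet M) fun b => ?_
    change (∀ a ∈ y, g (b * a) ∈ z) ↔ ∀ n, (∃ a ∈ y, n ≤ g a) → g b * n ∈ z
    simp only [map_mul]
    exact ⟨fun h n ⟨a, ha, hn⟩ => z.lower (mul_le_mul_right hn _) (h a ha),
      fun h a ha => h _ ⟨a, ha, le_rfl⟩⟩
  unit_le_iff (x : LowerSet N) := by
    refine LowerSet.Iic_le.trans (Iff.trans ?_ LowerSet.Iic_le.symm)
    change 1 ∈ x ↔ g 1 ∈ x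
    rw [map_one]

/-- Taking preimages of downsets, as a functor. -/
def downsetFunctor : OrdMon.{u}ᵒᵖ ⥤ DerACDL.{u} where
  obj M := M.unop.toDerACDL
  map f := preimageHom f.unop

instance : downsetFunctor.Faithful where
  map_injective {N M} f f' h := by
    apply Quiver.Hom.unop_inj
    let g : M.unop →*o N.unop := f.unop
    let g' : M.unop →*o N.unop := f'.unop
    change g = g'
    have h' : ∀ (A : LowerSet N.unop) (m : M.unop), g m ∈ A ↔ g' m ∈ A := fun A m => by
      have := congrArg (fun k : DerACDL.Hom _ _ => (m ∈ (k.hom A : LowerSet M.unop))) h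
      exact iff_of_eq this
    refine DFunLike.ext _ _ fun m => le_antisymm ?_ ?_
    · exact (h' (LowerSet.Iic (g' m)) m).2 le_rfl
    · exact (h' (LowerSet.Iic (g m)) m).1 le_rfl

/-- The left adjoint of a residuation morphism preserves primes, that is, principal downsets. Its
action on their generators is the required homomorphism, multiplicative because the left adjoint
preserves products. -/
instance : downsetFunctor.Full where
  map_surjective {N M} f := by
    let F : CompleteLatticeHom (LowerSet N.unop) (LowerSet M.unop) := DerACDL.Hom.hom f
    have hmul : ∀ a b, leftAdj F (M.unop.derivationStr.mul a b) =
        N.unop.derivationStr.mul (leftAdj F a) (leftAdj F b) :=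
      (residuation_conditions_iff N.unop.derivationStr.toResiduationStr
        M.unop.derivationStr.toResiduationStr F).1
        ⟨DerACDL.Hom.forth_lres f, DerACDL.Hom.forth_rres f, DerACDL.Hom.back_lres f,
          DerACDL.Hom.back_rres f⟩
    choose g hg using fun m : M.unop =>
      exists_eq_Iic ((isCompletelyJoinPrime_Iic m).leftAdj F)
    have hmem : ∀ m A, m ∈ F A ↔ g m ∈ A := fun m A => by
      rw [← LowerSet.Iic_le, ← leftAdj_hom_le_iff, hg, LowerSet.Iic_le]
    have hone : g 1 = 1 := by
      apply LowerSet.Iic_injective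
      rw [← hg]
      refine eq_of_forall_ge_iff fun A => ?_
      rw [leftAdj_hom_le_iff]
      exact (DerACDL.Hom.unit_le_iff f A).symm
    have hgmul : ∀ m m', g (m * m') = g m * g m' := fun m m' => by
      apply LowerSet.Iic_injective
      rw [← mul_Iic, ← hg, ← hg, ← hg, ← hmul, mul_Iic]
    have hmono : Monotone g := fun m m' h =>
      (hmem m _).1 ((F (LowerSet.Iic (g m'))).lower h ((hmem m' _).2 le_rfl))
    let g' : M.unop →*o N.unop :=
      { toFun := g, map_one' := hone, map_mul' := hgmul, monotone' := hmono }
    refine ⟨Quiver.Hom.op (show M.unop ⟶ N.unop from g'), ?_⟩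
    refine DerACDL.Hom.ext (DFunLike.ext _ _ fun A => LowerSet.ext (Set.ext fun m => ?_))
    exact (hmem m A).symm

end OrdMon

/-! ### Representation of derivation lattices by their primes. -/

namespace DerACDL

/-- Order isomorphisms that preserve products and units are isomorphisms of derivation lattices. -/
def homOfOrderIso {R S : DerACDL.{u}} (e : R.toACDL ≃o S.toACDL)
    (hmul : ∀ a b, e (R.str.mul a b) = S.str.mul (e a) (e b)) (hunit : e R.str.unit = S.str.unit) :
    R ⟶ S :=
  let f : CompleteLatticeHom R.toACDL S.toACDL :=
    { toFun := e
      map_sInf' := fun A => by rw [e.map_sInf, sInf_image]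
      map_sSup' := fun A => by rw [e.map_sSup, sSup_image] }
  have h : ∀ b, leftAdj f b = e.symm b := fun b => eq_of_forall_ge_iff fun x =>
    (leftAdj_hom_le_iff f).trans (e.symm_apply_le).symm
  have h' := (residuation_conditions_iff R.str.toResiduationStr S.str.toResiduationStr f).2
    fun a b => by rw [h, h, h, OrderIso.symm_apply_eq, hmul]; simp
  { hom := f
    forth_lres := h'.1
    forth_rres := h'.2.1
    back_lres := h'.2.2.1
    back_rres := h'.2.2.2
    unit_le_iff := fun x => by
      rw [← hunit]
      exact e.le_iff_le.symm }

/-- Order isomorphisms that preserve products and units are isomorphisms of derivation lattices. -/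
def isoOfOrderIso {R S : DerACDL.{u}} (e : R.toACDL ≃o S.toACDL)
    (hmul : ∀ a b, e (R.str.mul a b) = S.str.mul (e a) (e b)) (hunit : e R.str.unit = S.str.unit) :
    R ≅ S where
  hom := homOfOrderIso e hmul hunit
  inv := homOfOrderIso e.symm (fun a b => by rw [OrderIso.symm_apply_eq, hmul]; simp)
    (by rw [OrderIso.symm_apply_eq, hunit])
  hom_inv_id := DerACDL.Hom.ext (DFunLike.ext _ _ e.symm_apply_apply)
  inv_hom_id := DerACDL.Hom.ext (DFunLike.ext _ _ e.apply_symm_apply)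

/-- The ordered monoid of completely join-prime elements. -/
def primes (R : DerACDL.{u}) : OrdMon.{u} :=
  letI : Monoid {p : R.toACDL // IsCompletelyJoinPrime p} :=
    { mul := fun p q => ⟨R.str.mul p q, R.str.mul_prime p.2 q.2⟩
      one := ⟨R.str.unit, R.str.unit_prime⟩
      mul_assoc := fun p q r => Subtype.ext (R.str.mul_assoc p q r)
      one_mul := fun p => Subtype.ext (R.str.unit_mul p)
      mul_one := fun p => Subtype.ext (R.str.mul_unit p) }
  { carrier := {p : R.toACDL // IsCompletelyJoinPrime p}
    mulLeftMono := ⟨fun p _ _ h => R.str.mul_mono (le_refl p.1) h⟩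
    mulRightMono := ⟨fun p _ _ h => R.str.mul_mono h (le_refl p.1)⟩ }

/-- An element corresponds to the downset of completely join-prime elements below it. -/
def orderIsoLowerSetPrimes (R : DerACDL.{u}) : R.toACDL ≃o LowerSet R.primes where
  toFun x := ⟨{p | p.1 ≤ x}, fun _ _ h hp => le_trans h hp⟩
  invFun A := sSup {x | ∃ p ∈ A, Subtype.val p = x}
  left_inv x := by
    refine Eq.trans (congrArg sSup ?_) ((primeSeparated R.toACDL).sSup_prime_eq x)
    ext p
    exact ⟨fun ⟨q, hq, e⟩ => e ▸ ⟨q.2, hq⟩, fun h => ⟨⟨p, h.1⟩, h.2, rfl⟩⟩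
  right_inv A := by
    apply LowerSet.ext
    ext p
    constructor
    · intro h
      obtain ⟨_, ⟨q, hq, rfl⟩, hpq⟩ := p.2 _ h
      exact A.lower hpq hq
    · exact fun h => le_sSup ⟨p, h, rfl⟩
  map_rel_iff' {x y} := by
    rw [forall_prime_le_iff R.toACDL]
    exact ⟨fun h p hp hx => @h ⟨p, hp⟩ hx, fun h p hx => h p.1 p.2 hx⟩

/-- Every derivation lattice is isomorphic to a lattice of downsets. -/
def isoToDerACDLPrimes (R : DerACDL.{u}) : R ≅ R.primes.toDerACDL :=
  isoOfOrderIso R.orderIsoLowerSetPrimes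
    (fun a b => eq_of_forall_ge_iff fun C => by
      obtain ⟨z, rfl⟩ := R.orderIsoLowerSetPrimes.surjective C
      refine R.orderIsoLowerSetPrimes.le_iff_le.trans (Iff.trans ?_ OrdMon.mul_le_iff.symm)
      -- Products are determined by products of primes, and primes are the points of the downset
      -- lattice.
      rw [R.str.isProductOf_mul.le_iff_forall_prime]
      exact ⟨fun h p hp q hq => h p.1 p.2 hp q.1 q.2 hq,
        fun h p hp hpa q hq hqb => h ⟨p, hp⟩ hpa ⟨q, hq⟩ hqb⟩)
    rfl

end DerACDL

instance : OrdMon.downsetFunctor.EssSurj :=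
  ⟨fun R => ⟨Opposite.op R.primes, ⟨R.isoToDerACDLPrimes.symm⟩⟩⟩

instance : OrdMon.downsetFunctor.IsEquivalence := { }

instance : DerACDL.finite.IsClosedUnderIsomorphisms where
  of_iso {R S} i h := by
    have h : Finite R.toACDL := h
    refine Finite.of_injective (DerACDL.Hom.hom i.inv) (Function.LeftInverse.injective
      (g := DerACDL.Hom.hom i.hom) fun x => ?_)
    exact DFunLike.congr_fun (congrArg DerACDL.Hom.hom i.inv_hom_id) x

/-! ### Relational morphisms -/

/-- The ordered monoid with the opposite order. -/
def OrdMon.dual (M : OrdMon.{u}) : OrdMon.{u} where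
  carrier := M.carrierᵒᵈ
  mulLeftMono := ⟨fun a b c h => show OrderDual.ofDual (a * c) ≤ OrderDual.ofDual (a * b) from
    mul_le_mul_right (show OrderDual.ofDual c ≤ OrderDual.ofDual b from h) (OrderDual.ofDual a)⟩
  mulRightMono := ⟨fun a b c h => show OrderDual.ofDual (c * a) ≤ OrderDual.ofDual (b * a) from
    mul_le_mul_left (show OrderDual.ofDual c ≤ OrderDual.ofDual b from h) (OrderDual.ofDual a)⟩

/-- The preimage of upsets under an order relation. -/
def upsetPreimage {α β : Type*} [PartialOrder α] [PartialOrder β] (r : α →o LowerSet β) :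
    sSupHom (LowerSet βᵒᵈ) (LowerSet αᵒᵈ) where
  toFun A := ⟨{m | ∃ n ∈ A, OrderDual.ofDual n ∈ r (OrderDual.ofDual m)},
    -- Enlarging `m` enlarges `r m`, so preimages are closed upwards; this forces upsets in place of
    -- downsets.
    fun _ _ h ⟨n, hn, hm⟩ => ⟨n, hn, r.monotone h hm⟩⟩
  map_sSup' F := by
    refine SetLike.ext fun m => ?_
    rw [LowerSet.mem_sSup_iff, Set.exists_mem_image]
    constructor
    · rintro ⟨n, hn, hm⟩
      obtain ⟨A, hA, hn⟩ := LowerSet.mem_sSup_iff.1 hn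
      exact ⟨A, hA, n, hn, hm⟩
    · rintro ⟨A, hA, n, hn, hm⟩
      exact ⟨n, LowerSet.mem_sSup_iff.2 ⟨A, hA, hn⟩, hm⟩

/-- The relation is recovered from preimages of principal upsets, because each `r m` is a downset.
-/
theorem mem_upsetPreimage_Iic {α β : Type*} [PartialOrder α] [PartialOrder β]
    (r : α →o LowerSet β) (m : α) (n : β) :
    OrderDual.toDual m ∈ upsetPreimage r (LowerSet.Iic (OrderDual.toDual n)) ↔ n ∈ r m :=
  ⟨fun ⟨_, hn, hm⟩ => (r m).lower hn hm, fun h => ⟨_, le_refl (OrderDual.toDual n), h⟩⟩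

namespace RelOrdMon

/-- The derivation lattice of upsets of an ordered monoid. -/
def toRelDerACDL (M : RelOrdMon.{u}) : RelDerACDL.{u} := ⟨M.toOrdMon.dual.toDerACDL⟩

/-- Taking preimages of upsets under a relational morphism. -/
def preimageHom {M N : RelOrdMon.{u}} (r : RelOrdMon.Hom M N) :
    RelDerACDL.Hom N.toRelDerACDL M.toRelDerACDL where
  hom := (upsetPreimage r.rel :)
  map_top := by
    refine top_le_iff.1 fun m _ => ?_
    obtain ⟨n, hn⟩ := r.total (OrderDual.ofDual m)
    exact ⟨OrderDual.toDual n, trivial, hn⟩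
  lres_le := by
    rintro x z b ⟨n, hn, hb⟩ a ⟨n', hn', ha⟩
    exact ⟨n' * n, hn n' hn', r.mul_mem _ _ _ ha _ hb⟩
  unit_le := (LowerSet.Iic_le (a := OrderDual.toDual (1 : M.toOrdMon))).2
    ⟨OrderDual.toDual 1, le_refl (OrderDual.toDual (1 : N.toOrdMon)), r.one_mem⟩

/-- The relational morphism of a corelational morphism between lattices of upsets. -/
def ofRelDerACDLHom {M N : RelOrdMon.{u}} (f : RelDerACDL.Hom N.toRelDerACDL M.toRelDerACDL) :
    RelOrdMon.Hom M N :=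
  let F : sSupHom (LowerSet N.toOrdMon.carrierᵒᵈ) (LowerSet M.toOrdMon.carrierᵒᵈ) := f.hom
  { rel := ⟨fun m => ⟨{n | OrderDual.toDual m ∈ F (LowerSet.Iic (OrderDual.toDual n))},
        fun _ _ h hm => OrderHomClass.mono F (LowerSet.Iic_le.2 h) hm⟩,
      fun m _ h n hm => (F (LowerSet.Iic (OrderDual.toDual n))).lower h hm⟩
    total := fun m => by
      have htop : F ⊤ = ⊤ := f.map_top
      have hm : OrderDual.toDual m ∈ F ⊤ := htop ▸ trivial
      -- Totality: the top is the union of the principal upsets, and `F` preserves joins.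
      rw [lowerSet_eq_sSup_Iic ⊤, map_sSup, LowerSet.mem_sSup_iff] at hm
      obtain ⟨_, ⟨_, ⟨n, -, rfl⟩, rfl⟩, h⟩ := hm
      exact ⟨OrderDual.ofDual n, h⟩
    mul_mem := fun x y n hn n' hn' => by
      let A := LowerSet.Iic (OrderDual.toDual n)
      let B := LowerSet.Iic (OrderDual.toDual (n * n'))
      -- In the original order `A` and `B` are the upsets of `n` and `n * n'`. By monotonicity the
      -- upset of `n'` lies in `A \ B`, so the lax residual law yields multiplicativity.
      have h : LowerSet.Iic (OrderDual.toDual n') ≤ N.toOrdMon.dual.derivationStr.lres A B :=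
        LowerSet.Iic_le.2 fun a ha => mul_le_mul_left (α := N.toOrdMon) ha n'
      exact f.lres_le A B (OrderHomClass.mono F h hn') _ hn
    one_mem := (LowerSet.Iic_le (a := OrderDual.toDual (1 : M.toOrdMon))).1 f.unit_le }

/-- Taking preimages of upsets, as a functor. -/
def upsetFunctor : RelOrdMon.{u}ᵒᵖ ⥤ RelDerACDL.{u} where
  obj M := M.unop.toRelDerACDL
  map f := preimageHom f.unop
  map_id M := by
    refine RelDerACDL.Hom.ext (DFunLike.ext _ _ fun (A : LowerSet M.unop.toOrdMon.carrierᵒᵈ) => ?_)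
    refine SetLike.ext (A := LowerSet M.unop.toOrdMon.carrierᵒᵈ) fun m => ?_
    exact ⟨fun ⟨n, hn, h⟩ => A.lower h hn, fun h => ⟨m, h, le_refl (OrderDual.ofDual m)⟩⟩
  map_comp {M N P} f g := by
    refine RelDerACDL.Hom.ext (DFunLike.ext _ _ fun (A : LowerSet M.unop.toOrdMon.carrierᵒᵈ) => ?_)
    refine SetLike.ext (A := LowerSet P.unop.toOrdMon.carrierᵒᵈ) fun m => ?_
    constructor
    · rintro ⟨n, hn, h⟩
      obtain ⟨p, hp, h⟩ := LowerSet.mem_iSup₂_iff.1 h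
      exact ⟨OrderDual.toDual p, ⟨n, hn, h⟩, hp⟩
    · rintro ⟨p, ⟨n, hn, h⟩, hp⟩
      exact ⟨n, hn, LowerSet.mem_iSup₂_iff.2 ⟨p, hp, h⟩⟩

instance : upsetFunctor.Faithful where
  map_injective {N M} f f' h := by
    apply Quiver.Hom.unop_inj
    refine RelOrdMon.Hom.ext (OrderHom.ext _ _ (funext fun m => SetLike.ext fun n => ?_))
    rw [← mem_upsetPreimage_Iic, ← mem_upsetPreimage_Iic]
    have h' : upsetPreimage (RelOrdMon.Hom.rel f.unop) = upsetPreimage (RelOrdMon.Hom.rel f'.unop) :=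
      congrArg RelDerACDL.Hom.hom h
    rw [h']

/-- Every upset is a union of principal ones, so a join-preserving map is the preimage map of the
relation it defines on them. -/
instance : upsetFunctor.Full where
  map_surjective {N M} f := by
    refine ⟨Quiver.Hom.op (show M.unop ⟶ N.unop from ofRelDerACDLHom f), ?_⟩
    refine RelDerACDL.Hom.ext (DFunLike.ext _ _ fun (A : LowerSet N.unop.toOrdMon.carrierᵒᵈ) => ?_)
    refine SetLike.ext (A := LowerSet M.unop.toOrdMon.carrierᵒᵈ) fun m => ?_
    let F : sSupHom (LowerSet N.unop.toOrdMon.carrierᵒᵈ) (LowerSet M.unop.toOrdMon.carrierᵒᵈ) :=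
      RelDerACDL.Hom.hom f
    change (∃ n ∈ A, m ∈ F (LowerSet.Iic n)) ↔ m ∈ F A
    conv_rhs => rw [lowerSet_eq_sSup_Iic A, map_sSup, LowerSet.mem_sSup_iff,
      Set.exists_mem_image, Set.exists_mem_image]
    rfl

end RelOrdMon

/-- Residuation morphisms are corelational. -/
def DerACDL.toRelDerACDL : DerACDL.{u} ⥤ RelDerACDL.{u} where
  obj R := ⟨R⟩
  map f :=
    { hom := ⟨DerACDL.Hom.hom f, fun A => (DerACDL.Hom.hom f).map_sSup' A⟩
      map_top := map_top (DerACDL.Hom.hom f)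
      lres_le := DerACDL.Hom.forth_lres f
      unit_le := (DerACDL.Hom.unit_le_iff f _).1 le_rfl }

/-- Reversing the order of the monoid of primes twice restores it, so the representation by downsets
also serves here; residuation isomorphisms are corelational isomorphisms. -/
instance : RelOrdMon.upsetFunctor.EssSurj :=
  ⟨fun R => ⟨Opposite.op ⟨R.toDerACDL.primes.dual⟩,
    ⟨(DerACDL.toRelDerACDL.mapIso R.toDerACDL.isoToDerACDLPrimes).symm⟩⟩⟩

instance : RelOrdMon.upsetFunctor.IsEquivalence := { }

instance : RelDerACDL.finite.IsClosedUnderIsomorphisms where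
  of_iso {R S} i h := by
    have h : Finite R.toDerACDL.toACDL := h
    refine Finite.of_injective (RelDerACDL.Hom.hom i.inv) (Function.LeftInverse.injective
      (g := RelDerACDL.Hom.hom i.hom) fun x => ?_)
    exact DFunLike.congr_fun (congrArg RelDerACDL.Hom.hom i.inv_hom_id) x

end OrdDual

/-! ### The main theorem. -/

theorem mainTheorem4 :
    (∃ (E : OrdMon.{u}ᵒᵖ ≌ Comon.{u}) (I : Cat.of Comon.{u} ≅ Cat.of DerACDL.{u}),
      RestrictsDualEquiv E OrdMon.finite Comon.finite ∧
      RestrictsIso I Comon.finite DerACDL.finite) ∧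
    (∃ (E : RelOrdMon.{u}ᵒᵖ ≌ RelComon.{u}) (I : Cat.of RelComon.{u} ≅ Cat.of RelDerACDL.{u}),
      RestrictsDualEquiv E RelOrdMon.finite RelComon.finite ∧
      RestrictsIso I RelComon.finite RelDerACDL.finite) := by
  constructor
  · exact exists_dualEquiv_and_iso OrdMon.downsetFunctor comonToDerACDL DerACDL.toComon
      comonToDerACDL_obj_toComon toComon_comonToDerACDL_obj _ _ DerACDL.finite
      (fun M => (finite_lowerSet_iff M.unop.carrier).symm) (fun _ => Iff.rfl)
  · exact exists_dualEquiv_and_iso RelOrdMon.upsetFunctor relComonToRelDerACDL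
      (fun R => ⟨R.toDerACDL.toComon⟩)
      (fun R => congrArg RelDerACDL.mk (comonToDerACDL_obj_toComon R.toDerACDL))
      (fun C => congrArg RelComon.mk (toComon_comonToDerACDL_obj C.toComon)) _ _ RelDerACDL.finite
      (fun M => (finite_lowerSet_iff M.unop.toOrdMon.carrierᵒᵈ).symm) (fun _ => Iff.rfl)
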